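/- Let $E$ be a category with finite limits. A morphism $f\colon B\to A$ of $E$ is \emph{exponentiable} if the pullback functor $f^*\colon E/A\to E/B$ has a right adjoint $\Pi_f$. \emph{Polynomials.} A polynomial $p$ in $E$ is an exponentiable morphism $p\colon P_*\to P$. A morphism of polynomials $\phi\colon p\to q$ is a morphism $\phi_1\colon P\to Q$ together with a morphism $\phi^\sharp\colon P\times_Q Q_*\to P_*$ over $P$, where the pullback is formed along $\phi_1$ and $q$ (and pairs that differ only by the choice of this pullback are identified). The identity of $p$ is given by $\mathrm{id}_P$ and $P\times_P P_*\cong P_*$; the composite of $\phi\colon p\to q$ and $\psi\colon q\to r$ is given by $\psi_1\circ\phi_1$ and, on generalized elements, by $(x,z)\mapsto \phi^\sharp(x,\psi^\sharp(\phi_1(x),z))$. Let $\mathbf{Poly}_E$ be the resulting category. It is monoidal: the unit $y$ is $\mathrm{id}_1\colon 1\to 1$, and $p\triangleleft q$ is the composite of projections $$\bigl(\Pi_p(Q\times P_*)\times_P P_*\bigr)\times_Q Q_*\longrightarrow \Pi_p(Q\times P_*)\times_P P_*\longrightarrow \Pi_p(Q\times P_*),$$ where $Q \times P_*$ is regarded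 as an object over $P_*$ and the pullback over $Q$ is formed along $q$ and the composite of the evaluation $\Pi_p(Q\times P_*)\times_P P_*\to Q\times P_*$ with the projection to $Q$. In generalized elements, a position of $p\triangleleft q$ is a position $I$ of $p$ together with a map $J$ from the fibre $p[I]$ of $p$ over $I$ to $Q$, and a direction at $(I,J)$ is a direction $u$ of $p$ at $I$ together with a direction of $q$ at $J(u)$; the action of $\triangleleft$ on morphisms and the associativity and unit isomorphisms are the evident ones in these terms. \emph{Comonoids.} A $\triangleleft$-comonoid is a polynomial $c$ with morphisms $\epsilon\colon c\to y$ and $\delta\colon c\to c\triangleleft c$ that satisfy the counit and coassociativity laws; a homomorphism is a morphism of polynomials that commutes with the counits and the comultiplications. $\mathbf{Comon}(\mathbf{Poly}_E)$ is the category of $\triangleleft$-comonoids and homomorphisms. \emph{Internal categories.} A category $C$ internal to $E$ consists of $s,t\colon C_1\to C_0$, $i\colon C_0\to C_1$ and $k\colon C_1\times_{t,s}C_1\to C_1$ with $s i=\mathrm{id}=t i$, $s k=s\pi_1$, $t k=t\pi_2$ that satisfy the unit laws $k(i s(f),f)=f=k(f,i t(f))$ and the associative law $k(k(f,g),h)=k(f,k(g,h))$.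 An internal cofunctor $\phi\colon C\to C'$ is a morphism $\phi_1\colon C_0\to C_0'$ together with a morphism $\phi^\sharp\colon C_0\times_{\phi_1,s'}C_1'\to C_1$ over $C_0$ (that is, $s\phi^\sharp=\pi_1$; again up to the choice of the pullback) such that, on generalized elements, $$\phi^\sharp(x,i'(\phi_1(x)))=i(x),\qquad \phi_1(t(\phi^\sharp(x,f)))=t'(f),\qquad \phi^\sharp(x,k'(f,g))=k\bigl(\phi^\sharp(x,f),\phi^\sharp(t(\phi^\sharp(x,f)),g)\bigr).$$ Identities and composites of internal cofunctors are defined by the formulas for morphisms of polynomials. \textbf{Statement.} Internal categories in $E$ whose source morphism $s$ is exponentiable, with internal cofunctors as morphisms, form a category that is isomorphic to $\mathbf{Comon}(\mathbf{Poly}_E)$. Moreover, there is an isomorphism of categories that sends a comonoid with underlying polynomial $c$ to an internal category whose source morphism is $c$, and a homomorphism with underlying morphism of polynomials $(\phi_1,\phi^\sharp)$ to the internal cofunctor given by the same pair $(\phi_1,\phi^\sharp)$. -/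

import Mathlib

open CategoryTheory CategoryTheory.Limits

universe v u

namespace PolyComon

noncomputable section

attribute [local simp] pullback.lift_fst pullback.lift_fst_assoc pullback.lift_snd
  pullback.lift_snd_assoc

section Exponentiable

variable {E : Type u} [Category.{v} E] [HasPullbacks E]

/-- A morphism is exponentiable if pulling back along it has a right adjoint. -/
def IsExponentiable {A B : E} (f : B ⟶ A) : Prop :=
  (Over.pullback f).IsLeftAdjoint

theorem IsExponentiable.id (A : E) : IsExponentiable (𝟙 A) := by
  unfold IsExponentiable
  exact Functor.isLeftAdjoint_of_iso (Over.pullbackId (X := A)).symm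

theorem IsExponentiable.comp {A B C : E} {f : B ⟶ A} {g : C ⟶ B}
    (hf : IsExponentiable f) (hg : IsExponentiable g) : IsExponentiable (g ≫ f) := by
  unfold IsExponentiable at *
  exact Functor.isLeftAdjoint_of_iso (Over.pullbackComp g f).symm

section

variable {A B A' : E} (f : B ⟶ A) (g : A' ⟶ A)

/-- The map `X ×_A B ⟶ A' ×_A B` over `B`, for `X` over `A'`. -/
def slicedObj {X : E} (a : X ⟶ A') : pullback (a ≫ g) f ⟶ pullback g f :=
  pullback.lift (pullback.fst (a ≫ g) f ≫ a) (pullback.snd (a ≫ g) f)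
    (by simp [pullback.condition])

/-- The functoriality of `X ×_A B` in `X` over `A'`. -/
def slicedMap {X Y : E} (a : X ⟶ A') (b : Y ⟶ A') (h : X ⟶ Y) (w : h ≫ b = a) :
    pullback (a ≫ g) f ⟶ pullback (b ≫ g) f :=
  pullback.lift (pullback.fst (a ≫ g) f ≫ h) (pullback.snd (a ≫ g) f)
    (by simp [← w, ← pullback.condition])

theorem slicedMap_obj {X Y : E} (a : X ⟶ A') (b : Y ⟶ A') (h : X ⟶ Y) (w : h ≫ b = a) :
    slicedMap f g a b h w ≫ slicedObj f g b = slicedObj f g a := by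
  apply pullback.hom_ext <;> simp [slicedMap, slicedObj, w]

/-- The functor `Over A' ⥤ Over (A' ×_A B)` that pulls back along `f` in the slices. -/
def slicedPullback : Over A' ⥤ Over (pullback g f) where
  obj X := Over.mk (slicedObj f g X.hom)
  map {X Y} h := Over.homMk (slicedMap f g X.hom Y.hom h.left (Over.w h))
    (slicedMap_obj f g _ _ _ _)
  map_id X := by
    ext1
    change slicedMap f g X.hom X.hom (𝟙 X.left) (Category.id_comp _) = 𝟙 _
    apply pullback.hom_ext <;> simp [slicedMap]
  map_comp {X Y Z} h k := by
    ext1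
    change slicedMap f g X.hom Z.hom (h.left ≫ k.left) (Over.w (h ≫ k)) =
      slicedMap f g X.hom Y.hom h.left (Over.w h) ≫ slicedMap f g Y.hom Z.hom k.left (Over.w k)
    apply pullback.hom_ext <;> simp [slicedMap]

theorem slicedObj_iso {X : E} (a : X ⟶ A') :
    (pullbackRightPullbackFstIso g f a).inv ≫ pullback.snd a (pullback.fst g f) =
      slicedObj f g a := by
  apply pullback.hom_ext <;> simp [slicedObj, ← pullback.condition]

theorem slicedMap_iso {X Y : E} (a : X ⟶ A') (b : Y ⟶ A') (h : X ⟶ Y) (w : h ≫ b = a) :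
    slicedMap f g a b h w ≫ (pullbackRightPullbackFstIso g f b).inv =
      (pullbackRightPullbackFstIso g f a).inv ≫
        pullback.lift (pullback.fst a (pullback.fst g f) ≫ h) (pullback.snd a (pullback.fst g f))
          (by simp [w, pullback.condition]) := by
  apply pullback.hom_ext
  · simp [slicedMap]
  · apply pullback.hom_ext <;> simp [slicedMap, ← pullback.condition, w]

end

theorem IsExponentiable.pullback_fst {A B A' : E} {f : B ⟶ A} (hf : IsExponentiable f)
    (g : A' ⟶ A) : IsExponentiable (pullback.fst g f) := by
  unfold IsExponentiable at *
  let F : Over A' ⥤ Over (pullback g f) :=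
    (Over.iteratedSliceEquiv (Over.mk g)).inverse ⋙ Over.post (Over.pullback f) ⋙
      (Over.iteratedSliceEquiv ((Over.pullback f).obj (Over.mk g))).functor
  have hF : F.IsLeftAdjoint := by
    dsimp only [F]
    infer_instance
  have e : F = slicedPullback f g := rfl
  rw [e] at hF
  refine Functor.isLeftAdjoint_of_iso (F := slicedPullback f g) ?_
  refine NatIso.ofComponents
    (fun X => Over.isoMk (pullbackRightPullbackFstIso g f X.hom).symm
      (slicedObj_iso f g X.hom)) ?_
  intro X Y h
  ext1
  exact slicedMap_iso f g X.hom Y.hom h.left (Over.w h)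

end Exponentiable

theorem comp_lift {E : Type u} [Category.{v} E] [HasPullbacks E] {C B X Y Z : E} {f : X ⟶ Z}
    {g : Y ⟶ Z} (w : C ⟶ B) (a : B ⟶ X) (b : B ⟶ Y) (h : a ≫ f = b ≫ g) :
    w ≫ pullback.lift a b h = pullback.lift (w ≫ a) (w ≫ b) (by simp [h]) := by
  apply pullback.hom_ext <;> simp

variable {E : Type u} [Category.{v} E] [HasFiniteLimits E]

variable (E) in
/-- A polynomial in `E`: an exponentiable morphism `hom : dir ⟶ pos`. -/
structure Poly where
  /-- the object of positions -/
  pos : E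
  /-- the object of directions -/
  dir : E
  /-- the morphism -/
  hom : dir ⟶ pos
  exp : IsExponentiable hom

namespace Poly

/-- A morphism of polynomials. An isomorphism class of the defining diagrams, where the
isomorphisms are between choices of the pullback of `q.hom` along `pos`, has exactly one member
whose pullback is the chosen one. -/
structure Hom (p q : Poly E) where
  /-- the component on positions -/
  pos : p.pos ⟶ q.pos
  /-- the component on directions -/
  dir : pullback pos q.hom ⟶ p.dir
  dir_hom : dir ≫ p.hom = pullback.fst pos q.hom

namespace Hom

variable {p q r : Poly E}

/-- The action on generalized elements of the component on directions. -/
def app (φ : Hom p q) {B : E} (x : B ⟶ p.pos) (y : B ⟶ q.dir) (h : x ≫ φ.pos = y ≫ q.hom) :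
    B ⟶ p.dir :=
  pullback.lift x y h ≫ φ.dir

@[simp]
theorem app_hom (φ : Hom p q) {B : E} (x : B ⟶ p.pos) (y : B ⟶ q.dir)
    (h : x ≫ φ.pos = y ≫ q.hom) : φ.app x y h ≫ p.hom = x := by
  simp [app, φ.dir_hom]

@[simp]
theorem app_hom_assoc (φ : Hom p q) {B Z : E} (x : B ⟶ p.pos) (y : B ⟶ q.dir)
    (h : x ≫ φ.pos = y ≫ q.hom) (k : p.pos ⟶ Z) : φ.app x y h ≫ p.hom ≫ k = x ≫ k := by
  rw [← Category.assoc, app_hom]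

@[simp]
theorem comp_app (φ : Hom p q) {B C : E} (w : C ⟶ B) (x : B ⟶ p.pos) (y : B ⟶ q.dir)
    (h : x ≫ φ.pos = y ≫ q.hom) :
    w ≫ φ.app x y h = φ.app (w ≫ x) (w ≫ y) (by simp [h]) := by
  simp only [app, ← Category.assoc, comp_lift]

theorem dir_eq (φ : Hom p q) : φ.dir = φ.app (pullback.fst _ _) (pullback.snd _ _)
    pullback.condition := by
  have : pullback.lift (pullback.fst φ.pos q.hom) (pullback.snd φ.pos q.hom)
      pullback.condition = 𝟙 _ := by
    apply pullback.hom_ext <;> simp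
  simp [app, this]

theorem ext_app {φ ψ : Hom p q} (h₁ : φ.pos = ψ.pos)
    (h₂ : ∀ (B : E) (x : B ⟶ p.pos) (y : B ⟶ q.dir) (h : x ≫ φ.pos = y ≫ q.hom)
      (h' : x ≫ ψ.pos = y ≫ q.hom), φ.app x y h = ψ.app x y h') : φ = ψ := by
  have a := dir_eq φ
  have b := dir_eq ψ
  obtain ⟨f, d, e⟩ := φ
  obtain ⟨f', d', e'⟩ := ψ
  obtain rfl : f = f' := h₁
  obtain rfl : d = d' := by
    exact a.trans ((h₂ _ _ _ _ pullback.condition).trans b.symm)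
  rfl

/-- A morphism of polynomials from its component on positions and a natural action on
generalized elements. -/
def ofElements (f : p.pos ⟶ q.pos)
    (F : ∀ (B : E) (x : B ⟶ p.pos) (y : B ⟶ q.dir), x ≫ f = y ≫ q.hom → (B ⟶ p.dir))
    (hF : ∀ (B : E) (x : B ⟶ p.pos) (y : B ⟶ q.dir) (h : x ≫ f = y ≫ q.hom),
      F B x y h ≫ p.hom = x) : Hom p q where
  pos := f
  dir := F _ (pullback.fst f q.hom) (pullback.snd f q.hom) pullback.condition
  dir_hom := hF _ _ _ _

theorem ofElements_app (f : p.pos ⟶ q.pos)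
    (F : ∀ (B : E) (x : B ⟶ p.pos) (y : B ⟶ q.dir), x ≫ f = y ≫ q.hom → (B ⟶ p.dir))
    (hF : ∀ (B : E) (x : B ⟶ p.pos) (y : B ⟶ q.dir) (h : x ≫ f = y ≫ q.hom),
      F B x y h ≫ p.hom = x)
    (nat : ∀ (B C : E) (w : C ⟶ B) (x : B ⟶ p.pos) (y : B ⟶ q.dir) (h : x ≫ f = y ≫ q.hom),
      w ≫ F B x y h = F C (w ≫ x) (w ≫ y) (by simp [h]))
    {B : E} (x : B ⟶ p.pos) (y : B ⟶ q.dir) (h : x ≫ f = y ≫ q.hom) :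
    (ofElements f F hF).app x y h = F B x y h := by
  change pullback.lift x y h ≫ F _ _ _ _ = _
  rw [nat]
  congr 1 <;> simp

/-- The identity morphism. -/
def id (p : Poly E) : Hom p p where
  pos := 𝟙 p.pos
  dir := pullback.snd (𝟙 p.pos) p.hom
  dir_hom := by simp [← pullback.condition]

/-- The composite of morphisms of polynomials. Its component on directions is the composite of
`p.pos ×_{r.pos} r.dir ⟶ p.pos ×_{q.pos} q.dir`, induced by `ψ`, with that of `φ`. -/
def comp (φ : Hom p q) (ψ : Hom q r) : Hom p r where
  pos := φ.pos ≫ ψ.pos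
  dir := φ.app (pullback.fst (φ.pos ≫ ψ.pos) r.hom)
    (ψ.app (pullback.fst (φ.pos ≫ ψ.pos) r.hom ≫ φ.pos) (pullback.snd (φ.pos ≫ ψ.pos) r.hom)
      (by simp [← pullback.condition])) (by simp)
  dir_hom := by simp

theorem id_app (p : Poly E) {B : E} (x : B ⟶ p.pos) (y : B ⟶ p.dir)
    (h : x ≫ (Hom.id p).pos = y ≫ p.hom) : (Hom.id p).app x y h = y :=
  pullback.lift_snd _ _ _

theorem app_congr (φ : Hom p q) {B : E} {x x' : B ⟶ p.pos} {y y' : B ⟶ q.dir}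
    (h : x ≫ φ.pos = y ≫ q.hom) (hx : x = x') (hy : y = y') :
    φ.app x y h = φ.app x' y' (by rw [← hx, ← hy, h]) := by
  subst hx hy
  rfl

theorem comp_app' (φ : Hom p q) (ψ : Hom q r) {B : E} (x : B ⟶ p.pos) (y : B ⟶ r.dir)
    (h : x ≫ (Hom.comp φ ψ).pos = y ≫ r.hom) :
    (Hom.comp φ ψ).app x y h =
      φ.app x (ψ.app (x ≫ φ.pos) y (by simpa [comp] using h)) (by simp) := by
  have h' : x ≫ φ.pos ≫ ψ.pos = y ≫ r.hom := h
  change (pullback.lift x y h' : B ⟶ pullback (φ.pos ≫ ψ.pos) r.hom) ≫ φ.app _ _ _ = _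
  rw [comp_app]
  refine app_congr _ _ (pullback.lift_fst _ _ _) ?_
  rw [comp_app]
  refine app_congr _ _ ?_ (pullback.lift_snd _ _ _)
  rw [← Category.assoc, pullback.lift_fst]

end Hom

instance : Category (Poly E) where
  Hom p q := Hom p q
  id p := Hom.id p
  comp φ ψ := Hom.comp φ ψ
  id_comp φ := by
    refine Hom.ext_app (Category.id_comp _) ?_
    intro B x y h h'
    rw [Hom.comp_app', Hom.id_app]
    exact Hom.app_congr _ _ (Category.comp_id _) rfl
  comp_id φ := by
    refine Hom.ext_app (Category.comp_id _) ?_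
    intro B x y h h'
    rw [Hom.comp_app']
    exact Hom.app_congr _ _ rfl (Hom.id_app _ _ _ _)
  assoc φ ψ χ := by
    refine Hom.ext_app (Category.assoc _ _ _) ?_
    intro B x y h h'
    rw [Hom.comp_app', Hom.comp_app', Hom.comp_app']
    refine Hom.app_congr _ _ rfl ?_
    rw [Hom.comp_app']
    exact Hom.app_congr _ _ rfl (Hom.app_congr _ _ (Category.assoc _ _ _).symm rfl)

variable {p q r : Poly E}

@[simp] theorem id_pos (p : Poly E) : Hom.pos (𝟙 p) = 𝟙 p.pos := rfl

@[simp] theorem comp_pos (φ : p ⟶ q) (ψ : q ⟶ r) :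
    Hom.pos (φ ≫ ψ) = Hom.pos φ ≫ Hom.pos ψ := rfl

@[simp] theorem id_app (p : Poly E) {B : E} (x : B ⟶ p.pos) (y : B ⟶ p.dir)
    (h : x ≫ Hom.pos (𝟙 p) = y ≫ p.hom) : Hom.app (𝟙 p) x y h = y := by
  exact Hom.id_app p x y h

@[simp] theorem comp_app (φ : p ⟶ q) (ψ : q ⟶ r) {B : E} (x : B ⟶ p.pos) (y : B ⟶ r.dir)
    (h : x ≫ Hom.pos (φ ≫ ψ) = y ≫ r.hom) :
    Hom.app (φ ≫ ψ) x y h =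
      Hom.app φ x (Hom.app ψ (x ≫ Hom.pos φ) y (by simpa using h)) (by simp) := by
  exact Hom.comp_app' φ ψ x y h

theorem hom_ext {φ ψ : p ⟶ q} (h₁ : Hom.pos φ = Hom.pos ψ)
    (h₂ : ∀ (B : E) (x : B ⟶ p.pos) (y : B ⟶ q.dir) (h : x ≫ Hom.pos φ = y ≫ q.hom)
      (h' : x ≫ Hom.pos ψ = y ≫ q.hom), Hom.app φ x y h = Hom.app ψ x y h') : φ = ψ :=
  Hom.ext_app h₁ h₂


/-- The identity polynomial `𝟙 : 1 ⟶ 1`. -/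
def y : Poly E where
  pos := ⊤_ E
  dir := ⊤_ E
  hom := 𝟙 _
  exp := IsExponentiable.id _

section Tri

variable (p q)

/-- The object `q.pos × p.dir` over `p.dir`. -/
def prodOver : Over p.dir := Over.mk (prod.snd : q.pos ⨯ p.dir ⟶ p.dir)

/-- The dependent product of `q.pos × p.dir` along `p.hom`. -/
def piOver : Over p.pos :=
  haveI : (Over.pullback p.hom).IsLeftAdjoint := p.exp
  (Over.pullback p.hom).rightAdjoint.obj (prodOver p q)

/-- The adjunction between pullback and dependent product along `p.hom`. -/
def piEquiv (X : Over p.pos) :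
    ((Over.pullback p.hom).obj X ⟶ prodOver p q) ≃ (X ⟶ piOver p q) :=
  haveI : (Over.pullback p.hom).IsLeftAdjoint := p.exp
  (Adjunction.ofIsLeftAdjoint (Over.pullback p.hom)).homEquiv X (prodOver p q)

theorem piEquiv_naturality {X Y : Over p.pos} (w : Y ⟶ X)
    (f : (Over.pullback p.hom).obj X ⟶ prodOver p q) :
    piEquiv p q Y ((Over.pullback p.hom).map w ≫ f) = w ≫ piEquiv p q X f :=
  haveI : (Over.pullback p.hom).IsLeftAdjoint := p.exp
  Adjunction.homEquiv_naturality_left _ _ _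

/-- The projection from the dependent product to the positions of `p`. -/
def triπ : (piOver p q).left ⟶ p.pos := (piOver p q).hom

/-- The counit of the adjunction, followed by the projection to `q.pos`. -/
def piEval : pullback (triπ p q) p.hom ⟶ q.pos :=
  ((piEquiv p q (piOver p q)).symm (𝟙 _)).left ≫ (prod.fst : q.pos ⨯ p.dir ⟶ q.pos)

/-- The composite
`(Π_p (q.pos × p.dir) ×_{p.pos} p.dir) ×_{q.pos} q.dir ⟶ Π_p (q.pos × p.dir) ×_{p.pos} p.dir
  ⟶ Π_p (q.pos × p.dir)`
of a pullback of `q` and a pullback of `p`. -/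
def triHom : pullback (piEval p q) q.hom ⟶ (piOver p q).left :=
  pullback.fst (piEval p q) q.hom ≫ pullback.fst (triπ p q) p.hom

/-- The composition product `p ◁ q`. -/
abbrev tri : Poly E where
  pos := (piOver p q).left
  dir := pullback (piEval p q) q.hom
  hom := triHom p q
  exp := (p.exp.pullback_fst _).comp (q.exp.pullback_fst _)

/-- The projection from the directions of `p ◁ q` to those of `p`. -/
def triU : (tri p q).dir ⟶ p.dir :=
  pullback.fst (piEval p q) q.hom ≫ pullback.snd (triπ p q) p.hom

/-- The projection from the directions of `p ◁ q` to those of `q`. -/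
def triV : (tri p q).dir ⟶ q.dir := pullback.snd (piEval p q) q.hom

variable {p q}

/-- Evaluation of a position of `p ◁ q` at a direction of `p`. -/
def ev {B : E} (t : B ⟶ (tri p q).pos) (u : B ⟶ p.dir) (h : t ≫ triπ p q = u ≫ p.hom) :
    B ⟶ q.pos :=
  pullback.lift (f := triπ p q) t u h ≫ piEval p q

theorem ev_def {B : E} (t : B ⟶ (tri p q).pos) (u : B ⟶ p.dir)
    (h : t ≫ triπ p q = u ≫ p.hom) :
    ev t u h = pullback.lift (f := triπ p q) t u h ≫ piEval p q := rfl

/-- A direction of `p ◁ q` is a direction of `p` and one of `q`, at corresponding positions. -/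
def triDir {B : E} (t : B ⟶ (tri p q).pos) (u : B ⟶ p.dir) (v : B ⟶ q.dir)
    (h : t ≫ triπ p q = u ≫ p.hom) (h' : ev t u h = v ≫ q.hom) : B ⟶ (tri p q).dir :=
  pullback.lift (f := piEval p q) (pullback.lift (f := triπ p q) t u h) v
    ((ev_def t u h).symm.trans h')

/-- A position of `p ◁ q` is a position `σ` of `p` with a map from its directions to the
positions of `q`. -/
def triPos {B : E} (σ : B ⟶ p.pos) (f : pullback σ p.hom ⟶ q.pos) : B ⟶ (tri p q).pos :=
  (piEquiv p q (Over.mk σ) (Over.homMk (V := prodOver p q)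
    (prod.lift f (pullback.snd σ p.hom) : pullback σ p.hom ⟶ q.pos ⨯ p.dir)
    (prod.lift_snd _ _))).left

theorem comp_ev {B C : E} (w : C ⟶ B) (t : B ⟶ (tri p q).pos) (u : B ⟶ p.dir)
    (h : t ≫ triπ p q = u ≫ p.hom) :
    w ≫ ev t u h = ev (w ≫ t) (w ≫ u) (by simp [h]) := by
  unfold ev
  rw [← Category.assoc, comp_lift]

theorem comp_triDir {B C : E} (w : C ⟶ B) (t : B ⟶ (tri p q).pos) (u : B ⟶ p.dir)
    (v : B ⟶ q.dir) (h : t ≫ triπ p q = u ≫ p.hom) (h' : ev t u h = v ≫ q.hom) :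
    w ≫ triDir t u v h h' = triDir (w ≫ t) (w ≫ u) (w ≫ v) (by simp [h])
      (by rw [← comp_ev, h', Category.assoc]; exact h) := by
  apply pullback.hom_ext
  · apply pullback.hom_ext <;> simp [triDir]
  · simp [triDir]

theorem triPos_π {B : E} (σ : B ⟶ p.pos) (f : pullback σ p.hom ⟶ q.pos) :
    triPos σ f ≫ triπ p q = σ :=
  Over.w (piEquiv p q (Over.mk σ) _)

theorem triDir_hom {B : E} (t : B ⟶ (tri p q).pos) (u : B ⟶ p.dir) (v : B ⟶ q.dir)
    (h : t ≫ triπ p q = u ≫ p.hom) (h' : ev t u h = v ≫ q.hom) :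
    triDir t u v h h' ≫ triHom p q = t := by
  unfold triDir triHom
  rw [pullback.lift_fst_assoc, pullback.lift_fst]

theorem triDir_U {B : E} (t : B ⟶ (tri p q).pos) (u : B ⟶ p.dir) (v : B ⟶ q.dir)
    (h : t ≫ triπ p q = u ≫ p.hom) (h' : ev t u h = v ≫ q.hom) :
    triDir t u v h h' ≫ triU p q = u := by
  unfold triDir triU
  rw [pullback.lift_fst_assoc, pullback.lift_snd]

theorem triDir_V {B : E} (t : B ⟶ (tri p q).pos) (u : B ⟶ p.dir) (v : B ⟶ q.dir)
    (h : t ≫ triπ p q = u ≫ p.hom) (h' : ev t u h = v ≫ q.hom) :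
    triDir t u v h h' ≫ triV p q = v :=
  pullback.lift_snd _ _ _

theorem triU_hom : triU p q ≫ p.hom = triHom p q ≫ triπ p q := by
  rw [triU, triHom, Category.assoc, ← pullback.condition, ← Category.assoc]

theorem triV_hom : triV p q ≫ q.hom = ev (triHom p q) (triU p q) triU_hom.symm := by
  refine pullback.condition.symm.trans ?_
  unfold ev
  congr 1
  apply pullback.hom_ext
  · rw [pullback.lift_fst]
    rfl
  · rw [pullback.lift_snd]
    rfl

theorem triDir_ext {B : E} {d d' : B ⟶ (tri p q).dir}
    (h₁ : d ≫ triHom p q = d' ≫ triHom p q) (h₂ : d ≫ triU p q = d' ≫ triU p q)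
    (h₃ : d ≫ triV p q = d' ≫ triV p q) : d = d' := by
  refine pullback.hom_ext (pullback.hom_ext ?_ ?_) h₃
  · simpa only [triHom, Category.assoc] using h₁
  · simpa only [triU, Category.assoc] using h₂

theorem piEval_eq : piEval p q =
    (((piEquiv p q (piOver p q)).symm (𝟙 _)).left ≫ (prod.fst : q.pos ⨯ p.dir ⟶ q.pos) :
      pullback (triπ p q) p.hom ⟶ q.pos) := rfl

theorem map_comp_piEquiv_symm {X : Over p.pos} (w : X ⟶ piOver p q) :
    (Over.pullback p.hom).map w ≫ (piEquiv p q (piOver p q)).symm (𝟙 _) =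
      (piEquiv p q X).symm w := by
  apply (piEquiv p q X).injective
  rw [piEquiv_naturality]
  simp

theorem map_piEval {X : Over p.pos} (w : X ⟶ piOver p q) :
    pullback.lift (f := triπ p q) (pullback.fst X.hom p.hom ≫ w.left) (pullback.snd X.hom p.hom)
      ((Category.assoc _ _ _).trans (by
        rw [← pullback.condition]
        exact congrArg (fun k => pullback.fst X.hom p.hom ≫ k) (Over.w w))) ≫ piEval p q =
      ((piEquiv p q X).symm w).left ≫ (prod.fst : q.pos ⨯ p.dir ⟶ q.pos) := by
  have := congrArg (fun k => k.left ≫ (prod.fst : q.pos ⨯ p.dir ⟶ q.pos))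
    (map_comp_piEquiv_symm w)
  refine Eq.trans ?_ this
  exact (Category.assoc _ _ _).symm

theorem triPos_piEval {B : E} (σ : B ⟶ p.pos) (f : pullback σ p.hom ⟶ q.pos)
    (h : (pullback.fst σ p.hom ≫ triPos σ f) ≫ triπ p q = pullback.snd σ p.hom ≫ p.hom) :
    ev (pullback.fst σ p.hom ≫ triPos σ f) (pullback.snd σ p.hom) h = f := by
  have := map_piEval (piEquiv p q (Over.mk σ) (Over.homMk (V := prodOver p q)
    (prod.lift f (pullback.snd σ p.hom) : pullback σ p.hom ⟶ q.pos ⨯ p.dir)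
    (prod.lift_snd _ _)))
  refine Eq.trans ?_ (this.trans ?_)
  · rfl
  · rw [Equiv.symm_apply_apply]
    exact prod.lift_fst _ _

theorem ev_congr {B : E} {t t' : B ⟶ (tri p q).pos} {u u' : B ⟶ p.dir}
    (h : t ≫ triπ p q = u ≫ p.hom) (ht : t = t') (hu : u = u') :
    ev t u h = ev t' u' (by rw [← ht, ← hu, h]) := by
  subst ht hu
  rfl

theorem ev_comp_triPos {B C : E} (w : C ⟶ B) (σ : B ⟶ p.pos) (f : pullback σ p.hom ⟶ q.pos)
    (u : C ⟶ p.dir) (h : (w ≫ triPos σ f) ≫ triπ p q = u ≫ p.hom) :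
    ev (w ≫ triPos σ f) u h = pullback.lift w u
      (by rw [← h, Category.assoc, triPos_π]) ≫ f := by
  have h' : (pullback.fst σ p.hom ≫ triPos σ f) ≫ triπ p q = pullback.snd σ p.hom ≫ p.hom := by
    rw [Category.assoc, triPos_π, pullback.condition]
  refine Eq.trans ?_ (congrArg (fun k => pullback.lift w u
    (by rw [← h, Category.assoc, triPos_π]) ≫ k) (triPos_piEval σ f h'))
  rw [comp_ev]
  refine ev_congr _ ?_ ?_
  · simp
  · simp

theorem ev_triPos {B : E} (σ : B ⟶ p.pos) (f : pullback σ p.hom ⟶ q.pos) (u : B ⟶ p.dir)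
    (h : triPos σ f ≫ triπ p q = u ≫ p.hom) :
    ev (triPos σ f) u h = pullback.lift (𝟙 B) u
      (by rw [Category.id_comp, ← h, triPos_π]) ≫ f := by
  rw [← ev_comp_triPos (𝟙 B) σ f u (by rw [Category.id_comp, h])]
  exact ev_congr _ (Category.id_comp _).symm rfl

theorem triPos_ext {B : E} {t t' : B ⟶ (tri p q).pos} (h₁ : t ≫ triπ p q = t' ≫ triπ p q)
    (h₂ : ∀ (C : E) (w : C ⟶ B) (u : C ⟶ p.dir) (h : (w ≫ t) ≫ triπ p q = u ≫ p.hom)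
      (h' : (w ≫ t') ≫ triπ p q = u ≫ p.hom), ev (w ≫ t) u h = ev (w ≫ t') u h') : t = t' := by
  have key : ∀ (s : B ⟶ (tri p q).pos) (σ : B ⟶ p.pos) (hs : s ≫ triπ p q = σ),
      s = triPos σ (ev (pullback.fst σ p.hom ≫ s) (pullback.snd σ p.hom)
        (by rw [Category.assoc, hs, pullback.condition])) := by
    intro s σ hs
    have e := map_piEval (X := Over.mk σ) (Over.homMk s hs : Over.mk σ ⟶ piOver p q)
    have e2 : (piEquiv p q (Over.mk σ)).symm (Over.homMk s hs : Over.mk σ ⟶ piOver p q) =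
        Over.homMk (V := prodOver p q)
          (prod.lift (ev (pullback.fst σ p.hom ≫ s) (pullback.snd σ p.hom)
            (by rw [Category.assoc, hs, pullback.condition])) (pullback.snd σ p.hom) :
            pullback σ p.hom ⟶ q.pos ⨯ p.dir) (prod.lift_snd _ _) := by
      ext1
      apply prod.hom_ext
      · refine e.symm.trans ?_
        exact (prod.lift_fst _ _).symm
      · refine (Over.w ((piEquiv p q (Over.mk σ)).symm
          (Over.homMk s hs : Over.mk σ ⟶ piOver p q))).trans ?_
        exact (prod.lift_snd _ _).symm
    unfold triPos
    rw [← e2, Equiv.apply_symm_apply]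
    rfl
  rw [key t _ rfl, key t' _ h₁.symm]
  congr 1
  exact h₂ _ _ _ _ _

end Tri

section Elements

@[simp] theorem comp_ev_assoc {B C Z : E} (w : C ⟶ B) (t : B ⟶ (tri p q).pos) (u : B ⟶ p.dir)
    (h : t ≫ triπ p q = u ≫ p.hom) (k : q.pos ⟶ Z) :
    w ≫ ev t u h ≫ k = ev (w ≫ t) (w ≫ u) (by simp [h]) ≫ k := by
  rw [← Category.assoc, comp_ev]

@[simp] theorem triPos_π_assoc {B Z : E} (σ : B ⟶ p.pos) (f : pullback σ p.hom ⟶ q.pos)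
    (k : p.pos ⟶ Z) : triPos σ f ≫ triπ p q ≫ k = σ ≫ k := by
  rw [← Category.assoc, triPos_π]

@[simp] theorem triDir_hom_assoc {B Z : E} (t : B ⟶ (tri p q).pos) (u : B ⟶ p.dir)
    (v : B ⟶ q.dir) (h : t ≫ triπ p q = u ≫ p.hom) (h' : ev t u h = v ≫ q.hom)
    (k : (tri p q).pos ⟶ Z) : triDir t u v h h' ≫ triHom p q ≫ k = t ≫ k := by
  rw [← Category.assoc, triDir_hom]

@[simp] theorem triDir_U_assoc {B Z : E} (t : B ⟶ (tri p q).pos) (u : B ⟶ p.dir)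
    (v : B ⟶ q.dir) (h : t ≫ triπ p q = u ≫ p.hom) (h' : ev t u h = v ≫ q.hom)
    (k : p.dir ⟶ Z) : triDir t u v h h' ≫ triU p q ≫ k = u ≫ k := by
  rw [← Category.assoc, triDir_U]

@[simp] theorem triDir_V_assoc {B Z : E} (t : B ⟶ (tri p q).pos) (u : B ⟶ p.dir)
    (v : B ⟶ q.dir) (h : t ≫ triπ p q = u ≫ p.hom) (h' : ev t u h = v ≫ q.hom)
    (k : q.dir ⟶ Z) : triDir t u v h h' ≫ triV p q ≫ k = v ≫ k := by
  rw [← Category.assoc, triDir_V]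

theorem cond_U {B : E} {t : B ⟶ (tri p q).pos} {d : B ⟶ (tri p q).dir} (h : t = d ≫ triHom p q) :
    t ≫ triπ p q = (d ≫ triU p q) ≫ p.hom := by
  rw [h, Category.assoc, ← triU_hom, Category.assoc]

theorem cond_V {B : E} {t : B ⟶ (tri p q).pos} {d : B ⟶ (tri p q).dir} (h : t = d ≫ triHom p q) :
    ev t (d ≫ triU p q) (cond_U h) = (d ≫ triV p q) ≫ q.hom := by
  subst h
  rw [Category.assoc, triV_hom, comp_ev]

attribute [simp] triPos_π triDir_hom triDir_U triDir_V comp_ev comp_triDir ev_triPos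

end Elements

section Map

variable {p' q' : Poly E}

/-- The action of the composition product of two morphisms on generalized positions. -/
def triMapPos (φ : p ⟶ p') (ψ : q ⟶ q') {B : E} (t : B ⟶ (tri p q).pos) :
    B ⟶ (tri p' q').pos :=
  triPos (t ≫ triπ p q ≫ Hom.pos φ)
    (ev (pullback.fst (t ≫ triπ p q ≫ Hom.pos φ) p'.hom ≫ t)
      (Hom.app φ (pullback.fst (t ≫ triπ p q ≫ Hom.pos φ) p'.hom ≫ t ≫ triπ p q)
        (pullback.snd (t ≫ triπ p q ≫ Hom.pos φ) p'.hom)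
        (by rw [← pullback.condition]; simp))
      (by simp) ≫ Hom.pos ψ)

@[simp] theorem triMapPos_π (φ : p ⟶ p') (ψ : q ⟶ q') {B : E} (t : B ⟶ (tri p q).pos) :
    triMapPos φ ψ t ≫ triπ p' q' = t ≫ triπ p q ≫ Hom.pos φ := by
  simp [triMapPos]

@[simp] theorem triMapPos_π_assoc (φ : p ⟶ p') (ψ : q ⟶ q') {B Z : E} (t : B ⟶ (tri p q).pos)
    (k : p'.pos ⟶ Z) :
    triMapPos φ ψ t ≫ triπ p' q' ≫ k = t ≫ triπ p q ≫ Hom.pos φ ≫ k := by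
  simp [triMapPos]

@[simp] theorem ev_triMapPos (φ : p ⟶ p') (ψ : q ⟶ q') {B : E} (t : B ⟶ (tri p q).pos)
    (u : B ⟶ p'.dir) (h : triMapPos φ ψ t ≫ triπ p' q' = u ≫ p'.hom) :
    ev (triMapPos φ ψ t) u h =
      ev t (Hom.app φ (t ≫ triπ p q) u (by simpa using h)) (by simp) ≫ Hom.pos ψ := by
  simp [triMapPos]

@[simp] theorem comp_triMapPos (φ : p ⟶ p') (ψ : q ⟶ q') {B C : E} (w : C ⟶ B)
    (t : B ⟶ (tri p q).pos) : w ≫ triMapPos φ ψ t = triMapPos φ ψ (w ≫ t) := by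
  apply triPos_ext
  · simp
  · intro D x u h h'
    rw [ev_congr h (Category.assoc _ _ _).symm rfl]
    refine (ev_comp_triPos _ _ _ _ _).trans (Eq.trans ?_ (ev_comp_triPos _ _ _ _ _).symm)
    simp

/-- The composition product of two morphisms. -/
def triMap (φ : p ⟶ p') (ψ : q ⟶ q') : tri p q ⟶ tri p' q' :=
  Hom.ofElements (triMapPos φ ψ (𝟙 _))
    (fun B t d h => triDir t
      (Hom.app φ (t ≫ triπ p q) (d ≫ triU p' q')
        (by rw [← cond_U h]; simp))
      (Hom.app ψ (ev t (Hom.app φ (t ≫ triπ p q) (d ≫ triU p' q')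
        (by rw [← cond_U h]; simp)) (by simp)) (d ≫ triV p' q')
        (by rw [← cond_V h]; simp))
      (by simp) (by simp))
    (fun B t d h => by simp)

@[simp] theorem comp_triMap_pos (φ : p ⟶ p') (ψ : q ⟶ q') {B : E} (t : B ⟶ (tri p q).pos) :
    t ≫ Hom.pos (triMap φ ψ) = triMapPos φ ψ t := by
  simp [triMap, Hom.ofElements]

@[simp] theorem comp_triMap_pos_assoc (φ : p ⟶ p') (ψ : q ⟶ q') {B Z : E}
    (t : B ⟶ (tri p q).pos) (k : (tri p' q').pos ⟶ Z) :
    t ≫ Hom.pos (triMap φ ψ) ≫ k = triMapPos φ ψ t ≫ k := by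
  rw [← Category.assoc, comp_triMap_pos]

@[simp] theorem triMap_app (φ : p ⟶ p') (ψ : q ⟶ q') {B : E} (t : B ⟶ (tri p q).pos)
    (d : B ⟶ (tri p' q').dir) (h : t ≫ Hom.pos (triMap φ ψ) = d ≫ triHom p' q') :
    Hom.app (triMap φ ψ) t d h = triDir t
      (Hom.app φ (t ≫ triπ p q) (d ≫ triU p' q')
        (by rw [← cond_U h]; simp))
      (Hom.app ψ (ev t (Hom.app φ (t ≫ triπ p q) (d ≫ triU p' q')
        (by rw [← cond_U h]; simp)) (by simp)) (d ≫ triV p' q')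
        (by rw [← cond_V h]; simp))
      (by simp) (by simp) := by
  exact Hom.ofElements_app _ _ _ (by intros; simp) t d h

theorem tri_hom_ext {s : Poly E} {φ ψ : s ⟶ p}
    (h₁ : ∀ (B : E) (x : B ⟶ s.pos), x ≫ Hom.pos φ = x ≫ Hom.pos ψ)
    (h₂ : ∀ (B : E) (x : B ⟶ s.pos) (y : B ⟶ p.dir) (h : x ≫ Hom.pos φ = y ≫ p.hom)
      (h' : x ≫ Hom.pos ψ = y ≫ p.hom), Hom.app φ x y h = Hom.app ψ x y h') : φ = ψ :=
  hom_ext (by simpa using h₁ _ (𝟙 _)) h₂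

theorem triMap_id (p q : Poly E) : triMap (𝟙 p) (𝟙 q) = 𝟙 (tri p q) := by
  apply tri_hom_ext
  · intro B x
    apply triPos_ext
    · simp
    · intro C w u h h'
      simp
  · intro B x y h h'
    apply triDir_ext
    · simp at h'
      simp [h']
    · simp
    · simp

theorem triMap_comp {p'' q'' : Poly E} (φ : p ⟶ p') (ψ : q ⟶ q') (φ' : p' ⟶ p'') (ψ' : q' ⟶ q'') :
    triMap φ ψ ≫ triMap φ' ψ' = triMap (φ ≫ φ') (ψ ≫ ψ') := by
  apply tri_hom_ext
  · intro B x
    apply triPos_ext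
    · simp
    · intro C w u h h'
      simp
  · intro B x y h h'
    apply triDir_ext
    · simp
    · simp
    · simp

end Map

section Associator

theorem comp_triPos_eq {B C : E} (w : C ⟶ B) (σ : B ⟶ p.pos) (f : pullback σ p.hom ⟶ q.pos)
    (σ' : C ⟶ p.pos) (f' : pullback σ' p.hom ⟶ q.pos) (hσ : w ≫ σ = σ')
    (hf : ∀ (D : E) (x : D ⟶ C) (u : D ⟶ p.dir) (h : (x ≫ w) ≫ σ = u ≫ p.hom)
      (h' : x ≫ σ' = u ≫ p.hom), pullback.lift (x ≫ w) u h ≫ f = pullback.lift x u h' ≫ f') :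
    w ≫ triPos σ f = triPos σ' f' := by
  apply triPos_ext
  · simpa
  · intro D x u h h'
    rw [ev_congr h (Category.assoc _ _ _).symm rfl, ev_comp_triPos, ev_comp_triPos]
    exact hf _ _ _ _ _

theorem triDir_eta {B : E} {t : B ⟶ (tri p q).pos} {d : B ⟶ (tri p q).dir}
    (h : t = d ≫ triHom p q) (h₁ : t ≫ triπ p q = (d ≫ triU p q) ≫ p.hom)
    (h₂ : ev t (d ≫ triU p q) h₁ = (d ≫ triV p q) ≫ q.hom) :
    triDir t (d ≫ triU p q) (d ≫ triV p q) h₁ h₂ = d :=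
  triDir_ext (by simpa using h) (by simp) (by simp)

/-- The value at a direction `u` of `p` of the position of `p ◁ (q ◁ r)` that corresponds to the
position `s` of `(p ◁ q) ◁ r`. -/
def assocInner {B : E} (s : B ⟶ (tri (tri p q) r).pos) (u : B ⟶ p.dir)
    (h : s ≫ triπ (tri p q) r ≫ triπ p q = u ≫ p.hom) : B ⟶ (tri q r).pos :=
  triPos (ev (s ≫ triπ (tri p q) r) u (by simpa using h))
    (ev (pullback.fst (ev (s ≫ triπ (tri p q) r) u (by simpa using h)) q.hom ≫ s)
      (triDir (pullback.fst (ev (s ≫ triπ (tri p q) r) u (by simpa using h)) q.hom ≫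
          s ≫ triπ (tri p q) r)
        (pullback.fst (ev (s ≫ triπ (tri p q) r) u (by simpa using h)) q.hom ≫ u)
        (pullback.snd (ev (s ≫ triπ (tri p q) r) u (by simpa using h)) q.hom)
        (by simp [h])
        (by rw [← pullback.condition, comp_ev]))
      (by simp))

@[simp] theorem assocInner_π {B : E} (s : B ⟶ (tri (tri p q) r).pos) (u : B ⟶ p.dir)
    (h : s ≫ triπ (tri p q) r ≫ triπ p q = u ≫ p.hom) :
    assocInner s u h ≫ triπ q r = ev (s ≫ triπ (tri p q) r) u (by simpa using h) :=
  triPos_π _ _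

@[simp] theorem assocInner_π_assoc {B Z : E} (s : B ⟶ (tri (tri p q) r).pos) (u : B ⟶ p.dir)
    (h : s ≫ triπ (tri p q) r ≫ triπ p q = u ≫ p.hom) (k : q.pos ⟶ Z) :
    assocInner s u h ≫ triπ q r ≫ k = ev (s ≫ triπ (tri p q) r) u (by simpa using h) ≫ k :=
  triPos_π_assoc _ _ _

@[simp] theorem comp_assocInner {B C : E} (w : C ⟶ B) (s : B ⟶ (tri (tri p q) r).pos)
    (u : B ⟶ p.dir) (h : s ≫ triπ (tri p q) r ≫ triπ p q = u ≫ p.hom) :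
    w ≫ assocInner s u h = assocInner (w ≫ s) (w ≫ u) (by simp [h]) :=
  comp_triPos_eq _ _ _ _ _ (by simp) (by intros; simp)

@[simp] theorem ev_assocInner {B : E} (s : B ⟶ (tri (tri p q) r).pos) (u : B ⟶ p.dir)
    (h : s ≫ triπ (tri p q) r ≫ triπ p q = u ≫ p.hom) (v : B ⟶ q.dir)
    (h' : assocInner s u h ≫ triπ q r = v ≫ q.hom) :
    ev (assocInner s u h) v h' = ev s (triDir (s ≫ triπ (tri p q) r) u v (by simpa using h)
      (by rw [← h', assocInner_π])) (by simp) := by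
  simp [assocInner]

/-- The associator on generalized positions. -/
def assocPos {B : E} (s : B ⟶ (tri (tri p q) r).pos) : B ⟶ (tri p (tri q r)).pos :=
  triPos (s ≫ triπ (tri p q) r ≫ triπ p q)
    (assocInner (pullback.fst (s ≫ triπ (tri p q) r ≫ triπ p q) p.hom ≫ s)
      (pullback.snd (s ≫ triπ (tri p q) r ≫ triπ p q) p.hom)
      (by rw [← pullback.condition]; simp))

@[simp] theorem assocPos_π {B : E} (s : B ⟶ (tri (tri p q) r).pos) :
    assocPos s ≫ triπ p (tri q r) = s ≫ triπ (tri p q) r ≫ triπ p q :=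
  triPos_π _ _

@[simp] theorem assocPos_π_assoc {B Z : E} (s : B ⟶ (tri (tri p q) r).pos) (k : p.pos ⟶ Z) :
    assocPos s ≫ triπ p (tri q r) ≫ k = s ≫ triπ (tri p q) r ≫ triπ p q ≫ k := by
  simp [assocPos]

@[simp] theorem comp_assocPos {B C : E} (w : C ⟶ B) (s : B ⟶ (tri (tri p q) r).pos) :
    w ≫ assocPos s = assocPos (w ≫ s) :=
  comp_triPos_eq _ _ _ _ _ (by simp) (by intros; simp)

@[simp] theorem ev_assocPos {B : E} (s : B ⟶ (tri (tri p q) r).pos) (u : B ⟶ p.dir)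
    (h : assocPos s ≫ triπ p (tri q r) = u ≫ p.hom) :
    ev (assocPos s) u h = assocInner s u (by rw [← h, assocPos_π]) := by
  simp [assocPos]

/-- The associator. -/
def assocHom (p q r : Poly E) : tri (tri p q) r ⟶ tri p (tri q r) :=
  Hom.ofElements (assocPos (𝟙 _))
    (fun B s d h => triDir s
      (triDir (s ≫ triπ (tri p q) r) (d ≫ triU p (tri q r)) (d ≫ triV p (tri q r) ≫ triU q r)
        (by rw [← cond_U h]; simp)
        (by rw [← Category.assoc d, ← cond_U (cond_V h)]; simp))
      (d ≫ triV p (tri q r) ≫ triV q r)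
      (by simp)
      (by rw [← Category.assoc d (triV p (tri q r)) (triV q r), ← cond_V (cond_V h)]; simp))
    (fun B s d h => by simp)

@[simp] theorem comp_assocHom_pos {B : E} (s : B ⟶ (tri (tri p q) r).pos) :
    s ≫ Hom.pos (assocHom p q r) = assocPos s := by
  simp [assocHom, Hom.ofElements]

@[simp] theorem comp_assocHom_pos_assoc {B Z : E} (s : B ⟶ (tri (tri p q) r).pos)
    (k : (tri p (tri q r)).pos ⟶ Z) :
    s ≫ Hom.pos (assocHom p q r) ≫ k = assocPos s ≫ k := by
  rw [← Category.assoc, comp_assocHom_pos]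

@[simp] theorem assocHom_app {B : E} (s : B ⟶ (tri (tri p q) r).pos)
    (d : B ⟶ (tri p (tri q r)).dir)
    (h : s ≫ Hom.pos (assocHom p q r) = d ≫ triHom p (tri q r)) :
    Hom.app (assocHom p q r) s d h = triDir s
      (triDir (s ≫ triπ (tri p q) r) (d ≫ triU p (tri q r)) (d ≫ triV p (tri q r) ≫ triU q r)
        (by rw [← cond_U h]; simp)
        (by rw [← Category.assoc d, ← cond_U (cond_V h)]; simp))
      (d ≫ triV p (tri q r) ≫ triV q r)
      (by simp)
      (by rw [← Category.assoc d (triV p (tri q r)) (triV q r), ← cond_V (cond_V h)]; simp) :=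
  Hom.ofElements_app _ _ _ (by intros; simp) s d h

/-- The position of `p ◁ q` underlying a position of `p ◁ (q ◁ r)`. -/
def assocInvBase {B : E} (s : B ⟶ (tri p (tri q r)).pos) : B ⟶ (tri p q).pos :=
  triPos (s ≫ triπ p (tri q r))
    (ev (pullback.fst (s ≫ triπ p (tri q r)) p.hom ≫ s)
      (pullback.snd (s ≫ triπ p (tri q r)) p.hom)
      (by rw [Category.assoc, pullback.condition]) ≫ triπ q r)

@[simp] theorem assocInvBase_π {B : E} (s : B ⟶ (tri p (tri q r)).pos) :
    assocInvBase s ≫ triπ p q = s ≫ triπ p (tri q r) :=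
  triPos_π _ _

@[simp] theorem assocInvBase_π_assoc {B Z : E} (s : B ⟶ (tri p (tri q r)).pos) (k : p.pos ⟶ Z) :
    assocInvBase s ≫ triπ p q ≫ k = s ≫ triπ p (tri q r) ≫ k := by
  simp [assocInvBase]

@[simp] theorem comp_assocInvBase {B C : E} (w : C ⟶ B) (s : B ⟶ (tri p (tri q r)).pos) :
    w ≫ assocInvBase s = assocInvBase (w ≫ s) :=
  comp_triPos_eq _ _ _ _ _ (by simp) (by intros; simp)

@[simp] theorem ev_assocInvBase {B : E} (s : B ⟶ (tri p (tri q r)).pos) (u : B ⟶ p.dir)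
    (h : assocInvBase s ≫ triπ p q = u ≫ p.hom) :
    ev (assocInvBase s) u h = ev s u (by rw [← h, assocInvBase_π]) ≫ triπ q r := by
  simp [assocInvBase]

/-- The value at a direction `d` of `p ◁ q` of the position of `(p ◁ q) ◁ r` that corresponds to
the position `s` of `p ◁ (q ◁ r)`. -/
def assocInvInner {B : E} (s : B ⟶ (tri p (tri q r)).pos) (d : B ⟶ (tri p q).dir)
    (h : assocInvBase s = d ≫ triHom p q) : B ⟶ r.pos :=
  ev (ev s (d ≫ triU p q) (by rw [← cond_U h]; simp)) (d ≫ triV p q)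
    (by rw [← cond_V h]; simp)

@[simp] theorem comp_assocInvInner {B C : E} (w : C ⟶ B) (s : B ⟶ (tri p (tri q r)).pos)
    (d : B ⟶ (tri p q).dir) (h : assocInvBase s = d ≫ triHom p q) :
    w ≫ assocInvInner s d h = assocInvInner (w ≫ s) (w ≫ d)
      (by rw [← comp_assocInvBase, h, Category.assoc]) := by
  simp [assocInvInner]

/-- The inverse of the associator on generalized positions. -/
def assocInvPos {B : E} (s : B ⟶ (tri p (tri q r)).pos) : B ⟶ (tri (tri p q) r).pos :=
  triPos (p := tri p q) (assocInvBase s)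
    (assocInvInner (pullback.fst (assocInvBase s) (triHom p q) ≫ s)
      (pullback.snd (assocInvBase s) (triHom p q))
      (by rw [← comp_assocInvBase, pullback.condition]))

@[simp] theorem assocInvPos_π {B : E} (s : B ⟶ (tri p (tri q r)).pos) :
    assocInvPos s ≫ triπ (tri p q) r = assocInvBase s :=
  triPos_π _ _

@[simp] theorem assocInvPos_π_assoc {B Z : E} (s : B ⟶ (tri p (tri q r)).pos)
    (k : (tri p q).pos ⟶ Z) :
    assocInvPos s ≫ triπ (tri p q) r ≫ k = assocInvBase s ≫ k :=
  triPos_π_assoc _ _ _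

@[simp] theorem comp_assocInvPos {B C : E} (w : C ⟶ B) (s : B ⟶ (tri p (tri q r)).pos) :
    w ≫ assocInvPos s = assocInvPos (w ≫ s) :=
  comp_triPos_eq _ _ _ _ _ (by simp) (by intros; simp)

@[simp] theorem ev_assocInvPos {B : E} (s : B ⟶ (tri p (tri q r)).pos) (d : B ⟶ (tri p q).dir)
    (h : assocInvPos s ≫ triπ (tri p q) r = d ≫ triHom p q) :
    ev (assocInvPos s) d h = ev (ev s (d ≫ triU p q)
        (by rw [← cond_U ((assocInvPos_π s).symm.trans h)]; simp)) (d ≫ triV p q)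
      (by rw [← cond_V ((assocInvPos_π s).symm.trans h)]; simp) := by
  simp [assocInvPos, assocInvInner]

/-- The inverse of the associator. -/
def assocInv (p q r : Poly E) : tri p (tri q r) ⟶ tri (tri p q) r :=
  Hom.ofElements (assocInvPos (𝟙 _))
    (fun B s d h => triDir s (d ≫ triU (tri p q) r ≫ triU p q)
      (triDir (ev s (d ≫ triU (tri p q) r ≫ triU p q)
          (by rw [← Category.assoc d, ← cond_U (cond_U h)]; simp))
        (d ≫ triU (tri p q) r ≫ triV p q) (d ≫ triV (tri p q) r)
        (by rw [← Category.assoc d _ (triV p q), ← cond_V (cond_U h)]; simp)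
        (by rw [← cond_V h]; simp))
      (by rw [← Category.assoc d, ← cond_U (cond_U h)]; simp)
      (by simp))
    (fun B s d h => by simp)

@[simp] theorem comp_assocInv_pos {B : E} (s : B ⟶ (tri p (tri q r)).pos) :
    s ≫ Hom.pos (assocInv p q r) = assocInvPos s := by
  simp [assocInv, Hom.ofElements]

@[simp] theorem comp_assocInv_pos_assoc {B Z : E} (s : B ⟶ (tri p (tri q r)).pos)
    (k : (tri (tri p q) r).pos ⟶ Z) :
    s ≫ Hom.pos (assocInv p q r) ≫ k = assocInvPos s ≫ k := by
  rw [← Category.assoc, comp_assocInv_pos]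

@[simp] theorem assocInv_app {B : E} (s : B ⟶ (tri p (tri q r)).pos)
    (d : B ⟶ (tri (tri p q) r).dir)
    (h : s ≫ Hom.pos (assocInv p q r) = d ≫ triHom (tri p q) r) :
    Hom.app (assocInv p q r) s d h = triDir s (d ≫ triU (tri p q) r ≫ triU p q)
      (triDir (ev s (d ≫ triU (tri p q) r ≫ triU p q)
          (by rw [← Category.assoc d, ← cond_U (cond_U h)]; simp))
        (d ≫ triU (tri p q) r ≫ triV p q) (d ≫ triV (tri p q) r)
        (by rw [← Category.assoc d _ (triV p q), ← cond_V (cond_U h)]; simp)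
        (by rw [← cond_V h]; simp))
      (by rw [← Category.assoc d, ← cond_U (cond_U h)]; simp)
      (by simp) :=
  Hom.ofElements_app _ _ _ (by intros; simp) s d h

/-- The associativity isomorphism of the composition product. -/
def assocIso (p q r : Poly E) : tri (tri p q) r ≅ tri p (tri q r) where
  hom := assocHom p q r
  inv := assocInv p q r
  hom_inv_id := by
    apply tri_hom_ext
    · intro B x
      apply triPos_ext
      · apply triPos_ext
        · simp
        · intro C w u h h'
          simp
      · intro C w u h h'
        simp only [id_pos, Category.comp_id] at h'
        simp
        exact ev_congr _ rfl (triDir_eta ((Category.assoc _ _ _).symm.trans h') _ _)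
    · intro B x y h h'
      simp only [id_pos, Category.comp_id] at h'
      subst h'
      apply triDir_ext
      · simp
      · apply triDir_ext
        · simp only [comp_app, assocHom_app, assocInv_app, triDir_U, triDir_hom, id_app]
          exact cond_U rfl
        · simp
        · simp
      · simp
  inv_hom_id := by
    apply tri_hom_ext
    · intro B x
      apply triPos_ext
      · simp
      · intro C w u h h'
        apply triPos_ext
        · simp
        · intro D z v k k'
          simp
    · intro B x y h h'
      simp only [id_pos, Category.comp_id] at h'
      subst h'
      apply triDir_ext
      · simp
      · simp
      · apply triDir_ext
        · simp only [comp_app, assocHom_app, assocInv_app, triDir_V, triDir_hom, id_app]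
          refine Eq.trans (ev_congr _ rfl ?_) (cond_V (p := p) (q := tri q r) rfl)
          simp
        · simp
        · simp

end Associator

section Unitors

/-- The unique generalized element of `1`. -/
def one (B : E) : B ⟶ (y : Poly E).pos := terminal.from B

theorem one_ext {B : E} (f g : B ⟶ (y : Poly E).pos) : f = g :=
  terminal.hom_ext f g

theorem one_ext' {B : E} (f g : B ⟶ (y : Poly E).dir) : f = g :=
  terminal.hom_ext f g

/-- The unique generalized direction of the identity polynomial. -/
def oneDir (B : E) : B ⟶ (y : Poly E).dir := terminal.from B

@[simp] theorem comp_one {B C : E} (w : C ⟶ B) : w ≫ one B = one C := one_ext _ _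

@[simp] theorem comp_oneDir {B C : E} (w : C ⟶ B) : w ≫ oneDir B = oneDir C := one_ext' _ _

/-- The left unitor on generalized positions. -/
def leftPos {B : E} (t : B ⟶ (tri y p).pos) : B ⟶ p.pos := ev t (oneDir B) (one_ext _ _)

@[simp] theorem comp_leftPos {B C : E} (w : C ⟶ B) (t : B ⟶ (tri y p).pos) :
    w ≫ leftPos t = leftPos (w ≫ t) := by
  simp [leftPos]

theorem ev_one {B : E} (t : B ⟶ (tri y p).pos) (u : B ⟶ (y : Poly E).dir)
    (h : t ≫ triπ y p = u ≫ (y : Poly E).hom) : ev t u h = leftPos t :=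
  ev_congr _ rfl (one_ext' _ _)

/-- The inverse of the left unitor on generalized positions. -/
def leftInvPos {B : E} (x : B ⟶ p.pos) : B ⟶ (tri y p).pos :=
  triPos (one B) (pullback.fst (one B) (y : Poly E).hom ≫ x)

@[simp] theorem comp_leftInvPos {B C : E} (w : C ⟶ B) (x : B ⟶ p.pos) :
    w ≫ leftInvPos x = leftInvPos (w ≫ x) :=
  comp_triPos_eq _ _ _ _ _ (one_ext _ _) (by intros; simp)

@[simp] theorem leftPos_inv {B : E} (x : B ⟶ p.pos) : leftPos (leftInvPos x) = x := by
  simp [leftPos, leftInvPos]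

/-- The left unitor. -/
def leftHom (p : Poly E) : tri y p ⟶ p :=
  Hom.ofElements (leftPos (𝟙 _))
    (fun B t z h => triDir t (oneDir B) z (one_ext _ _)
      (by rw [ev_one, ← h, comp_leftPos, Category.comp_id]))
    (fun B t z h => by simp)

@[simp] theorem comp_leftHom_pos {B : E} (t : B ⟶ (tri y p).pos) :
    t ≫ Hom.pos (leftHom p) = leftPos t := by
  simp [leftHom, Hom.ofElements]

@[simp] theorem comp_leftHom_pos_assoc {B Z : E} (t : B ⟶ (tri y p).pos) (k : p.pos ⟶ Z) :
    t ≫ Hom.pos (leftHom p) ≫ k = leftPos t ≫ k := by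
  rw [← Category.assoc, comp_leftHom_pos]

@[simp] theorem leftHom_app {B : E} (t : B ⟶ (tri y p).pos) (z : B ⟶ p.dir)
    (h : t ≫ Hom.pos (leftHom p) = z ≫ p.hom) :
    Hom.app (leftHom p) t z h = triDir t (oneDir B) z (one_ext _ _)
      (by rw [ev_one, ← h, comp_leftHom_pos]) :=
  Hom.ofElements_app _ _ _ (by intros; simp) t z h

/-- The inverse of the left unitor. -/
def leftInv (p : Poly E) : p ⟶ tri y p :=
  Hom.ofElements (leftInvPos (𝟙 _))
    (fun B x d h => d ≫ triV y p)
    (fun B x d h => by rw [← cond_V h, ev_one]; simp)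

@[simp] theorem comp_leftInv_pos {B : E} (x : B ⟶ p.pos) :
    x ≫ Hom.pos (leftInv p) = leftInvPos x := by
  simp [leftInv, Hom.ofElements]

@[simp] theorem comp_leftInv_pos_assoc {B Z : E} (x : B ⟶ p.pos) (k : (tri y p).pos ⟶ Z) :
    x ≫ Hom.pos (leftInv p) ≫ k = leftInvPos x ≫ k := by
  rw [← Category.assoc, comp_leftInv_pos]

@[simp] theorem leftInv_app {B : E} (x : B ⟶ p.pos) (d : B ⟶ (tri y p).dir)
    (h : x ≫ Hom.pos (leftInv p) = d ≫ triHom y p) :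
    Hom.app (leftInv p) x d h = d ≫ triV y p :=
  Hom.ofElements_app _ _ _ (by intros; simp) x d h

/-- The left unit isomorphism of the composition product. -/
def leftIso (p : Poly E) : tri y p ≅ p where
  hom := leftHom p
  inv := leftInv p
  hom_inv_id := by
    apply tri_hom_ext
    · intro B x
      apply triPos_ext
      · exact one_ext _ _
      · intro C w u h h'
        simp [ev_one]
    · intro B x z h h'
      simp only [id_pos, Category.comp_id] at h'
      subst h'
      apply triDir_ext
      · simp
      · exact one_ext' _ _
      · simp
  inv_hom_id := by
    apply tri_hom_ext
    · intro B x
      simp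
    · intro B x z h h'
      simp

/-- The inverse of the right unitor on generalized positions. -/
def rightInvPos {B : E} (x : B ⟶ p.pos) : B ⟶ (tri p y).pos :=
  triPos x (one _)

@[simp] theorem comp_rightInvPos {B C : E} (w : C ⟶ B) (x : B ⟶ p.pos) :
    w ≫ rightInvPos x = rightInvPos (w ≫ x) :=
  comp_triPos_eq _ _ _ _ _ rfl (by intros; exact one_ext _ _)

@[simp] theorem rightInvPos_π {B : E} (x : B ⟶ p.pos) : rightInvPos x ≫ triπ p y = x :=
  triPos_π _ _

@[simp] theorem rightInvPos_π_assoc {B Z : E} (x : B ⟶ p.pos) (k : p.pos ⟶ Z) :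
    rightInvPos x ≫ triπ p y ≫ k = x ≫ k :=
  triPos_π_assoc _ _ _

/-- The right unitor. -/
def rightHom (p : Poly E) : tri p y ⟶ p :=
  Hom.ofElements (triπ p y)
    (fun B t u h => triDir t u (oneDir B) h (one_ext _ _))
    (fun B t z h => by simp)

@[simp] theorem rightHom_pos : Hom.pos (rightHom p) = triπ p y := rfl

@[simp] theorem rightHom_app {B : E} (t : B ⟶ (tri p y).pos) (u : B ⟶ p.dir)
    (h : t ≫ Hom.pos (rightHom p) = u ≫ p.hom) :
    Hom.app (rightHom p) t u h = triDir t u (oneDir B) (by rw [← h, rightHom_pos])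
      (one_ext _ _) :=
  Hom.ofElements_app _ _ _
    (fun B _ w x k h => (comp_triDir w x k (oneDir B) h (one_ext _ _)).trans
      (by simp only [comp_oneDir])) t u h

/-- The inverse of the right unitor. -/
def rightInv (p : Poly E) : p ⟶ tri p y :=
  Hom.ofElements (rightInvPos (𝟙 _))
    (fun B x d h => d ≫ triU p y)
    (fun B x d h => by rw [← cond_U h]; simp)

@[simp] theorem comp_rightInv_pos {B : E} (x : B ⟶ p.pos) :
    x ≫ Hom.pos (rightInv p) = rightInvPos x := by
  simp [rightInv, Hom.ofElements]

@[simp] theorem comp_rightInv_pos_assoc {B Z : E} (x : B ⟶ p.pos) (k : (tri p y).pos ⟶ Z) :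
    x ≫ Hom.pos (rightInv p) ≫ k = rightInvPos x ≫ k := by
  rw [← Category.assoc, comp_rightInv_pos]

@[simp] theorem rightInv_app {B : E} (x : B ⟶ p.pos) (d : B ⟶ (tri p y).dir)
    (h : x ≫ Hom.pos (rightInv p) = d ≫ triHom p y) :
    Hom.app (rightInv p) x d h = d ≫ triU p y :=
  Hom.ofElements_app _ _ _ (by intros; simp) x d h

/-- The right unit isomorphism of the composition product. -/
def rightIso (p : Poly E) : tri p y ≅ p where
  hom := rightHom p
  inv := rightInv p
  hom_inv_id := by
    apply tri_hom_ext
    · intro B x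
      apply triPos_ext
      · simp
      · intro C w u h h'
        exact one_ext _ _
    · intro B x z h h'
      simp only [id_pos, Category.comp_id] at h'
      subst h'
      apply triDir_ext
      · simp
      · simp
      · exact one_ext' _ _
  inv_hom_id := by
    apply tri_hom_ext
    · intro B x
      simp
    · intro B x z h h'
      simp

end Unitors

section Monoidal

variable {p' q' r' s : Poly E}

theorem assoc_naturality (φ : p ⟶ p') (ψ : q ⟶ q') (χ : r ⟶ r') :
    triMap (triMap φ ψ) χ ≫ assocHom p' q' r' = assocHom p q r ≫ triMap φ (triMap ψ χ) := by
  apply tri_hom_ext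
  · intro B x
    apply triPos_ext
    · simp
    · intro C w u h h'
      apply triPos_ext
      · simp
      · intro D z v k k'
        simp
  · intro B x d h h'
    apply triDir_ext
    · simp
    · apply triDir_ext
      · simp
      · simp
      · simp
    · simp

theorem left_naturality (φ : p ⟶ p') :
    triMap (𝟙 y) φ ≫ leftHom p' = leftHom p ≫ φ := by
  apply tri_hom_ext
  · intro B x
    simp [leftPos]
  · intro B x d h h'
    apply triDir_ext
    · simp
    · exact one_ext' _ _
    · simp [leftPos]

theorem right_naturality (φ : p ⟶ p') :
    triMap φ (𝟙 y) ≫ rightHom p' = rightHom p ≫ φ := by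
  apply tri_hom_ext
  · intro B x
    simp
  · intro B x d h h'
    apply triDir_ext
    · simp
    · simp
    · exact one_ext' _ _

theorem triMap_app_U (φ : p ⟶ p') (ψ : q ⟶ q') {B : E} (t : B ⟶ (tri p q).pos)
    (d : B ⟶ (tri p' q').dir) (h : t ≫ Hom.pos (triMap φ ψ) = d ≫ triHom p' q') :
    Hom.app (triMap φ ψ) t d h ≫ triU p q =
      Hom.app φ (t ≫ triπ p q) (d ≫ triU p' q') (by rw [← cond_U h]; simp) := by
  rw [triMap_app, triDir_U]

theorem triMap_app_V_id (φ : p ⟶ p') {B : E} (t : B ⟶ (tri p q).pos)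
    (d : B ⟶ (tri p' q).dir) (h : t ≫ Hom.pos (triMap φ (𝟙 q)) = d ≫ triHom p' q) :
    Hom.app (triMap φ (𝟙 q)) t d h ≫ triV p q = d ≫ triV p' q := by
  rw [triMap_app, triDir_V, id_app]

theorem triMap_app_U_id (ψ : q ⟶ q') {B : E} (t : B ⟶ (tri p q).pos)
    (d : B ⟶ (tri p q').dir) (h : t ≫ Hom.pos (triMap (𝟙 p) ψ) = d ≫ triHom p q') :
    Hom.app (triMap (𝟙 p) ψ) t d h ≫ triU p q = d ≫ triU p q' := by
  rw [triMap_app, triDir_U, id_app]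

theorem triMap_app_V (φ : p ⟶ p') (ψ : q ⟶ q') {B : E} (t : B ⟶ (tri p q).pos)
    (d : B ⟶ (tri p' q').dir) (h : t ≫ Hom.pos (triMap φ ψ) = d ≫ triHom p' q') :
    Hom.app (triMap φ ψ) t d h ≫ triV p q =
      Hom.app ψ (ev t (Hom.app φ (t ≫ triπ p q) (d ≫ triU p' q')
        (by rw [← cond_U h]; simp)) (by simp)) (d ≫ triV p' q')
        (by rw [← cond_V h]; simp) := by
  rw [triMap_app, triDir_V]

theorem assocHom_app_UU {B : E} (s : B ⟶ (tri (tri p q) r).pos)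
    (d : B ⟶ (tri p (tri q r)).dir)
    (h : s ≫ Hom.pos (assocHom p q r) = d ≫ triHom p (tri q r)) :
    Hom.app (assocHom p q r) s d h ≫ triU (tri p q) r ≫ triU p q = d ≫ triU p (tri q r) := by
  rw [assocHom_app, triDir_U_assoc, triDir_U]

theorem assocHom_app_UV {B : E} (s : B ⟶ (tri (tri p q) r).pos)
    (d : B ⟶ (tri p (tri q r)).dir)
    (h : s ≫ Hom.pos (assocHom p q r) = d ≫ triHom p (tri q r)) :
    Hom.app (assocHom p q r) s d h ≫ triU (tri p q) r ≫ triV p q =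
      d ≫ triV p (tri q r) ≫ triU q r := by
  rw [assocHom_app, triDir_U_assoc, triDir_V]

theorem assocHom_app_V {B : E} (s : B ⟶ (tri (tri p q) r).pos)
    (d : B ⟶ (tri p (tri q r)).dir)
    (h : s ≫ Hom.pos (assocHom p q r) = d ≫ triHom p (tri q r)) :
    Hom.app (assocHom p q r) s d h ≫ triV (tri p q) r = d ≫ triV p (tri q r) ≫ triV q r := by
  rw [assocHom_app, triDir_V]

theorem triU_hom_ext {B : E} {d d' : B ⟶ (tri p q).dir}
    (h₀ : d ≫ triHom p q = d' ≫ triHom p q) :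
    (d ≫ triU p q) ≫ p.hom = (d' ≫ triU p q) ≫ p.hom :=
  (cond_U h₀.symm).symm.trans (Category.assoc _ _ _) |>.trans
    (congrArg (fun k => d' ≫ k) triU_hom).symm |>.trans (Category.assoc _ _ _).symm

theorem triDir_ext_U {B : E} {d d' : B ⟶ (tri (tri p q) r).dir}
    (h₀ : d ≫ triHom (tri p q) r = d' ≫ triHom (tri p q) r)
    (h₁ : (d ≫ triU (tri p q) r) ≫ triU p q = (d' ≫ triU (tri p q) r) ≫ triU p q)
    (h₂ : (d ≫ triU (tri p q) r) ≫ triV p q = (d' ≫ triU (tri p q) r) ≫ triV p q) :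
    d ≫ triU (tri p q) r = d' ≫ triU (tri p q) r := by
  exact triDir_ext (triU_hom_ext h₀) h₁ h₂

theorem tri_pentagon_pos (p q r s : Poly E) {B : E} (x : B ⟶ (tri (tri (tri p q) r) s).pos) :
    x ≫ Hom.pos (triMap (assocHom p q r) (𝟙 s) ≫ assocHom p (tri q r) s ≫
        triMap (𝟙 p) (assocHom q r s)) =
      x ≫ Hom.pos (assocHom (tri p q) r s ≫ assocHom p q (tri r s)) := by
  apply triPos_ext
  · simp
  · intro C w u h h'
    apply triPos_ext
    · simp
    · intro D z v k k'
      apply triPos_ext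
      · simp
      · intro F a b c c'
        simp

theorem tri_pentagon_aux {B : E} (x : B ⟶ (tri (tri (tri p q) r) s).pos)
    (y₁ : B ⟶ (tri (tri p (tri q r)) s).pos) (y₂ : B ⟶ (tri p (tri (tri q r) s)).pos)
    (y₃ : B ⟶ (tri (tri p q) (tri r s)).pos) (d : B ⟶ (tri p (tri q (tri r s))).dir)
    (k₂ : y₂ ≫ Hom.pos (triMap (𝟙 p) (assocHom q r s)) = d ≫ triHom p (tri q (tri r s)))
    (k₁ : y₁ ≫ Hom.pos (assocHom p (tri q r) s) =
      Hom.app (triMap (𝟙 p) (assocHom q r s)) y₂ d k₂ ≫ triHom p (tri (tri q r) s))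
    (k₀ : x ≫ Hom.pos (triMap (assocHom p q r) (𝟙 s)) =
      Hom.app (assocHom p (tri q r) s) y₁ (Hom.app (triMap (𝟙 p) (assocHom q r s)) y₂ d k₂) k₁ ≫
        triHom (tri p (tri q r)) s)
    (k₃ : y₃ ≫ Hom.pos (assocHom p q (tri r s)) = d ≫ triHom p (tri q (tri r s)))
    (k₄ : x ≫ Hom.pos (assocHom (tri p q) r s) =
      Hom.app (assocHom p q (tri r s)) y₃ d k₃ ≫ triHom (tri p q) (tri r s)) :
    Hom.app (triMap (assocHom p q r) (𝟙 s)) x (Hom.app (assocHom p (tri q r) s) y₁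
        (Hom.app (triMap (𝟙 p) (assocHom q r s)) y₂ d k₂) k₁) k₀ =
      Hom.app (assocHom (tri p q) r s) x (Hom.app (assocHom p q (tri r s)) y₃ d k₃) k₄ := by
  have h₀ := (Hom.app_hom (triMap (assocHom p q r) (𝟙 s)) x _ k₀).trans
    (Hom.app_hom (assocHom (tri p q) r s) x _ k₄).symm
  have eU := triMap_app_U (assocHom p q r) (𝟙 s) x _ k₀
  have eV := triMap_app_V_id (assocHom p q r) x _ k₀
  generalize Hom.app (triMap (assocHom p q r) (𝟙 s)) x _ k₀ = e at h₀ eU eV ⊢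
  have fUU := assocHom_app_UU x _ k₄
  have fUV := assocHom_app_UV x _ k₄
  have fV := assocHom_app_V x _ k₄
  generalize Hom.app (assocHom (tri p q) r s) x _ k₄ = f at h₀ fUU fUV fV ⊢
  have gUU := assocHom_app_UU y₃ d k₃
  have gUV := assocHom_app_UV y₃ d k₃
  have gV := assocHom_app_V y₃ d k₃
  generalize Hom.app (assocHom p q (tri r s)) y₃ d k₃ = g at *
  have aUU := assocHom_app_UU y₁ _ k₁
  have aUV := assocHom_app_UV y₁ _ k₁
  have aV := assocHom_app_V y₁ _ k₁
  generalize Hom.app (assocHom p (tri q r) s) y₁ _ k₁ = a at *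
  have bU := triMap_app_U_id (assocHom q r s) y₂ d k₂
  have bV := triMap_app_V (𝟙 p) (assocHom q r s) y₂ d k₂
  generalize Hom.app (triMap (𝟙 p) (assocHom q r s)) y₂ d k₂ = b at *
  have mUU := (congrArg (fun k => k ≫ triU (tri p q) r ≫ triU p q) eU).trans
    (assocHom_app_UU _ _ _)
  have mUV := (congrArg (fun k => k ≫ triU (tri p q) r ≫ triV p q) eU).trans
    (assocHom_app_UV _ _ _)
  have mV := (congrArg (fun k => k ≫ triV (tri p q) r) eU).trans (assocHom_app_V _ _ _)
  have nUU := (congrArg (fun k => k ≫ triU (tri q r) s ≫ triU q r) bV).trans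
    (assocHom_app_UU _ _ _)
  have nUV := (congrArg (fun k => k ≫ triU (tri q r) s ≫ triV q r) bV).trans
    (assocHom_app_UV _ _ _)
  have nV := (congrArg (fun k => k ≫ triV (tri q r) s) bV).trans (assocHom_app_V _ _ _)
  clear eU bV
  have V : e ≫ triV (tri (tri p q) r) s = f ≫ triV (tri (tri p q) r) s := by
    rw [eV, aV, fV, ← Category.assoc g, gV]
    simpa only [Category.assoc] using nV
  have UV : (e ≫ triU (tri (tri p q) r) s) ≫ triV (tri p q) r =
      (f ≫ triU (tri (tri p q) r) s) ≫ triV (tri p q) r := by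
    rw [Category.assoc f, fUV, ← Category.assoc g, gV]
    refine mV.trans ?_
    rw [← Category.assoc, Category.assoc a, aUV]
    simpa only [Category.assoc] using nUV
  have UUV : ((e ≫ triU (tri (tri p q) r) s) ≫ triU (tri p q) r) ≫ triV p q =
      ((f ≫ triU (tri (tri p q) r) s) ≫ triU (tri p q) r) ≫ triV p q := by
    rw [Category.assoc f, fUU, Category.assoc g, gUV, Category.assoc]
    refine mUV.trans ?_
    rw [← Category.assoc, Category.assoc a, aUV]
    simpa only [Category.assoc] using nUU
  have UUU : ((e ≫ triU (tri (tri p q) r) s) ≫ triU (tri p q) r) ≫ triU p q =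
      ((f ≫ triU (tri (tri p q) r) s) ≫ triU (tri p q) r) ≫ triU p q := by
    rw [Category.assoc f, fUU, Category.assoc g, gUU, Category.assoc]
    refine mUU.trans ?_
    rw [Category.assoc, aUU, bU]
  have h₁ : e ≫ triHom (tri (tri p q) r) s = f ≫ triHom (tri (tri p q) r) s := h₀
  refine triDir_ext h₁ (triDir_ext_U h₁ (triDir_ext ?_ UUU UUV) UV) V
  exact triU_hom_ext (p := tri p q) (triU_hom_ext h₁)

theorem tri_pentagon_dir (p q r s : Poly E) {B : E} (x : B ⟶ (tri (tri (tri p q) r) s).pos)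
    (d : B ⟶ (tri p (tri q (tri r s))).dir)
    (h : x ≫ Hom.pos (triMap (assocHom p q r) (𝟙 s) ≫ assocHom p (tri q r) s ≫
        triMap (𝟙 p) (assocHom q r s)) = d ≫ triHom p (tri q (tri r s)))
    (h' : x ≫ Hom.pos (assocHom (tri p q) r s ≫ assocHom p q (tri r s)) =
      d ≫ triHom p (tri q (tri r s))) :
    Hom.app (triMap (assocHom p q r) (𝟙 s) ≫ assocHom p (tri q r) s ≫
        triMap (𝟙 p) (assocHom q r s)) x d h =
      Hom.app (assocHom (tri p q) r s ≫ assocHom p q (tri r s)) x d h' := by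
  refine (comp_app _ _ _ _ _).trans
    ((Hom.app_congr _ _ rfl (comp_app _ _ _ _ _)).trans (Eq.trans ?_ (comp_app _ _ _ _ _).symm))
  exact tri_pentagon_aux _ _ _ _ _ _ _ _ _ _

theorem tri_pentagon (p q r s : Poly E) :
    triMap (assocHom p q r) (𝟙 s) ≫ assocHom p (tri q r) s ≫ triMap (𝟙 p) (assocHom q r s) =
      assocHom (tri p q) r s ≫ assocHom p q (tri r s) :=
  tri_hom_ext (fun _ x => tri_pentagon_pos p q r s x)
    (fun _ x d h h' => tri_pentagon_dir p q r s x d h h')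

theorem tri_triangle (p q : Poly E) :
    assocHom p y q ≫ triMap (𝟙 p) (leftHom q) = triMap (rightHom p) (𝟙 q) := by
  apply tri_hom_ext
  · intro B x
    apply triPos_ext
    · simp
    · intro C w u h h'
      simp [leftPos]
  · intro B x d h h'
    apply triDir_ext
    · simp
    · apply triDir_ext
      · simp
      · simp
      · exact one_ext' _ _
    · simp

instance : MonoidalCategoryStruct (Poly E) where
  tensorObj := tri
  whiskerLeft p _ _ φ := triMap (𝟙 p) φ
  whiskerRight φ p := triMap φ (𝟙 p)
  tensorHom := triMap
  tensorUnit := y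
  associator := assocIso
  leftUnitor := leftIso
  rightUnitor := rightIso

/-- Polynomials form a monoidal category under the composition product. -/
instance : MonoidalCategory (Poly E) :=
  MonoidalCategory.ofTensorHom
    (id_tensorHom_id := triMap_id)
    (id_tensorHom := fun _ _ _ _ => rfl)
    (tensorHom_id := fun _ _ => rfl)
    (tensorHom_comp_tensorHom := fun f₁ f₂ g₁ g₂ => triMap_comp f₁ f₂ g₁ g₂)
    (associator_naturality := fun f₁ f₂ f₃ => assoc_naturality f₁ f₂ f₃)
    (leftUnitor_naturality := fun f => left_naturality f)
    (rightUnitor_naturality := fun f => right_naturality f)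
    (pentagon := tri_pentagon)
    (triangle := tri_triangle)

end Monoidal

end Poly


section Internal

variable (E) in
/-- A category internal to `E`. -/
structure InternalCategory where
  /-- the object of objects -/
  obj : E
  /-- the object of arrows -/
  arr : E
  /-- source -/
  src : arr ⟶ obj
  /-- target -/
  tgt : arr ⟶ obj
  /-- identities -/
  ident : obj ⟶ arr
  /-- composition of `f` and `g` with `tgt f = src g`, in this order -/
  mul : pullback tgt src ⟶ arr
  ident_src : ident ≫ src = 𝟙 obj
  ident_tgt : ident ≫ tgt = 𝟙 obj
  mul_src : mul ≫ src = pullback.fst tgt src ≫ src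
  mul_tgt : mul ≫ tgt = pullback.snd tgt src ≫ tgt
  ident_mul : pullback.lift (src ≫ ident) (𝟙 arr) (by simp [ident_tgt]) ≫ mul = 𝟙 arr
  mul_ident : pullback.lift (𝟙 arr) (tgt ≫ ident) (by simp [ident_src]) ≫ mul = 𝟙 arr
  mul_assoc :
    pullback.lift (pullback.fst (pullback.snd tgt src ≫ tgt) src ≫ mul)
        (pullback.snd (pullback.snd tgt src ≫ tgt) src)
        (by rw [Category.assoc, mul_tgt, pullback.condition]) ≫ mul =
      pullback.lift (pullback.fst (pullback.snd tgt src ≫ tgt) src ≫ pullback.fst tgt src)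
        (pullback.lift (pullback.fst (pullback.snd tgt src ≫ tgt) src ≫ pullback.snd tgt src)
          (pullback.snd (pullback.snd tgt src ≫ tgt) src)
          (by rw [Category.assoc, pullback.condition]) ≫ mul)
        (by simp [mul_src, pullback.condition]) ≫ mul

/-- An internal cofunctor. An isomorphism class of the defining diagrams, where the isomorphisms
are between choices of the pullback of `D.src` along `pos`, has exactly one member whose pullback
is the chosen one. -/
structure Cofunctor (C D : InternalCategory E) where
  /-- the component on objects -/
  pos : C.obj ⟶ D.obj
  /-- the component on arrows -/
  dir : pullback pos D.src ⟶ C.arr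
  dir_src : dir ≫ C.src = pullback.fst pos D.src
  map_ident : pullback.lift (𝟙 C.obj) (pos ≫ D.ident) (by simp [D.ident_src]) ≫ dir = C.ident
  map_tgt : dir ≫ C.tgt ≫ pos = pullback.snd pos D.src ≫ D.tgt
  map_mul :
    pullback.lift
        (pullback.fst (pullback.snd pos D.src ≫ D.tgt) D.src ≫ pullback.fst pos D.src)
        (pullback.lift
          (pullback.fst (pullback.snd pos D.src ≫ D.tgt) D.src ≫ pullback.snd pos D.src)
          (pullback.snd (pullback.snd pos D.src ≫ D.tgt) D.src)
          (by rw [Category.assoc, pullback.condition]) ≫ D.mul)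
        (by simp [D.mul_src, pullback.condition]) ≫ dir =
      pullback.lift
        (pullback.fst (pullback.snd pos D.src ≫ D.tgt) D.src ≫ dir)
        (pullback.lift
          (pullback.fst (pullback.snd pos D.src ≫ D.tgt) D.src ≫ dir ≫ C.tgt)
          (pullback.snd (pullback.snd pos D.src ≫ D.tgt) D.src)
          (by simp only [Category.assoc, map_tgt, ← pullback.condition]) ≫ dir)
        (by simp [dir_src]) ≫ C.mul

/-- Composition of generalized arrows. -/
def InternalCategory.gmul (C : InternalCategory E) {B : E} (f g : B ⟶ C.arr)
    (h : f ≫ C.tgt = g ≫ C.src) : B ⟶ C.arr :=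
  pullback.lift f g h ≫ C.mul

namespace Cofunctor

variable {C D D' : InternalCategory E}

/-- The action on generalized elements of the component on arrows. -/
def app (φ : Cofunctor C D) {B : E} (x : B ⟶ C.obj) (f : B ⟶ D.arr)
    (h : x ≫ φ.pos = f ≫ D.src) : B ⟶ C.arr :=
  pullback.lift x f h ≫ φ.dir

theorem app_congr (φ : Cofunctor C D) {B : E} {x x' : B ⟶ C.obj} {f f' : B ⟶ D.arr}
    (h : x ≫ φ.pos = f ≫ D.src) (hx : x = x') (hf : f = f') :
    φ.app x f h = φ.app x' f' (by rw [← hx, ← hf, h]) := by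
  subst hx hf
  rfl

@[simp] theorem comp_app (φ : Cofunctor C D) {A B : E} (w : A ⟶ B) (x : B ⟶ C.obj)
    (f : B ⟶ D.arr) (h : x ≫ φ.pos = f ≫ D.src) :
    w ≫ φ.app x f h = φ.app (w ≫ x) (w ≫ f) (by simp [h]) := by
  simp only [app, ← Category.assoc, comp_lift]

@[simp] theorem comp_gmul {A B : E} (w : A ⟶ B) (f g : B ⟶ C.arr) (h : f ≫ C.tgt = g ≫ C.src) :
    w ≫ C.gmul f g h = C.gmul (w ≫ f) (w ≫ g) (by simp [h]) := by
  simp only [InternalCategory.gmul, ← Category.assoc, comp_lift]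

@[simp] theorem app_src (φ : Cofunctor C D) {B : E} (x : B ⟶ C.obj) (f : B ⟶ D.arr)
    (h : x ≫ φ.pos = f ≫ D.src) : φ.app x f h ≫ C.src = x := by
  rw [app, Category.assoc, φ.dir_src, pullback.lift_fst]

@[simp] theorem app_src_assoc (φ : Cofunctor C D) {B Z : E} (x : B ⟶ C.obj) (f : B ⟶ D.arr)
    (h : x ≫ φ.pos = f ≫ D.src) (k : C.obj ⟶ Z) : φ.app x f h ≫ C.src ≫ k = x ≫ k := by
  rw [← Category.assoc, app_src]

@[simp] theorem app_tgt (φ : Cofunctor C D) {B : E} (x : B ⟶ C.obj) (f : B ⟶ D.arr)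
    (h : x ≫ φ.pos = f ≫ D.src) : φ.app x f h ≫ C.tgt ≫ φ.pos = f ≫ D.tgt := by
  rw [app, Category.assoc, φ.map_tgt, ← Category.assoc, pullback.lift_snd]

@[simp] theorem app_tgt_assoc (φ : Cofunctor C D) {B Z : E} (x : B ⟶ C.obj) (f : B ⟶ D.arr)
    (h : x ≫ φ.pos = f ≫ D.src) (k : D.obj ⟶ Z) :
    φ.app x f h ≫ C.tgt ≫ φ.pos ≫ k = f ≫ D.tgt ≫ k := by
  rw [← Category.assoc C.tgt, ← Category.assoc, app_tgt, Category.assoc]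

theorem app_ident (φ : Cofunctor C D) {B : E} (x : B ⟶ C.obj)
    (h : x ≫ φ.pos = (x ≫ φ.pos ≫ D.ident) ≫ D.src) :
    φ.app x (x ≫ φ.pos ≫ D.ident) h = x ≫ C.ident := by
  have := congrArg (fun k => x ≫ k) φ.map_ident
  simpa [app, comp_lift, ← Category.assoc] using this

theorem app_gmul (φ : Cofunctor C D) {B : E} (x : B ⟶ C.obj) (f g : B ⟶ D.arr)
    (h : x ≫ φ.pos = f ≫ D.src) (h' : f ≫ D.tgt = g ≫ D.src)
    (h'' : x ≫ φ.pos = D.gmul f g h' ≫ D.src) :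
    φ.app x (D.gmul f g h') h'' =
      C.gmul (φ.app x f h) (φ.app (φ.app x f h ≫ C.tgt) g (by simp [h'])) (by simp) := by
  have := congrArg (fun k => pullback.lift (f := pullback.snd φ.pos D.src ≫ D.tgt)
    (pullback.lift x f h) g (by simpa using h') ≫ k) φ.map_mul
  simpa [app, InternalCategory.gmul, comp_lift, ← Category.assoc] using this

theorem dir_eq (φ : Cofunctor C D) : φ.dir = φ.app (pullback.fst _ _) (pullback.snd _ _)
    pullback.condition := by
  have : pullback.lift (pullback.fst φ.pos D.src) (pullback.snd φ.pos D.src)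
      pullback.condition = 𝟙 _ := by
    apply pullback.hom_ext <;> simp
  simp [app, this]

theorem ext_app {φ ψ : Cofunctor C D} (h₁ : φ.pos = ψ.pos)
    (h₂ : ∀ (B : E) (x : B ⟶ C.obj) (f : B ⟶ D.arr) (h : x ≫ φ.pos = f ≫ D.src)
      (h' : x ≫ ψ.pos = f ≫ D.src), φ.app x f h = ψ.app x f h') : φ = ψ := by
  have a := dir_eq φ
  have b := dir_eq ψ
  obtain ⟨f, d, _⟩ := φ
  obtain ⟨f', d', _⟩ := ψ
  obtain rfl : f = f' := h₁
  obtain rfl : d = d' := by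
    exact a.trans ((h₂ _ _ _ _ pullback.condition).trans b.symm)
  rfl

/-- The identity cofunctor. -/
def id (C : InternalCategory E) : Cofunctor C C where
  pos := 𝟙 C.obj
  dir := pullback.snd (𝟙 C.obj) C.src
  dir_src := by simp [← pullback.condition]
  map_ident := by simp
  map_tgt := by simp
  map_mul := by
    simp only [pullback.lift_snd]

/-- The component on arrows of the composite of internal cofunctors: the composite of
`C.obj ×_{D'.obj} D'.arr ⟶ C.obj ×_{D.obj} D.arr`, induced by `ψ.dir`, with `φ.dir`. -/
def compDir (φ : Cofunctor C D) (ψ : Cofunctor D D') :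
    pullback (φ.pos ≫ ψ.pos) D'.src ⟶ C.arr :=
  φ.app (pullback.fst (φ.pos ≫ ψ.pos) D'.src)
    (ψ.app (pullback.fst (φ.pos ≫ ψ.pos) D'.src ≫ φ.pos) (pullback.snd (φ.pos ≫ ψ.pos) D'.src)
      (by simp [← pullback.condition])) (by simp)

theorem lift_compDir (φ : Cofunctor C D) (ψ : Cofunctor D D') {B : E} (x : B ⟶ C.obj)
    (f : B ⟶ D'.arr) (h : x ≫ φ.pos ≫ ψ.pos = f ≫ D'.src) :
    pullback.lift x f h ≫ compDir φ ψ =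
      φ.app x (ψ.app (x ≫ φ.pos) f (by simpa using h)) (by simp) := by
  rw [compDir, comp_app]
  refine app_congr _ _ (pullback.lift_fst _ _ _) ?_
  rw [comp_app]
  refine app_congr _ _ ?_ (pullback.lift_snd _ _ _)
  rw [← Category.assoc, pullback.lift_fst]

theorem gmul_congr {B : E} {f f' g g' : B ⟶ C.arr} (h : f ≫ C.tgt = g ≫ C.src) (hf : f = f')
    (hg : g = g') : C.gmul f g h = C.gmul f' g' (by rw [← hf, ← hg, h]) := by
  subst hf hg
  rfl

theorem compDir_mul (φ : Cofunctor C D) (ψ : Cofunctor D D') {B : E}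
    (a : B ⟶ pullback (φ.pos ≫ ψ.pos) D'.src) (g : B ⟶ D'.arr)
    (hg : (a ≫ pullback.snd (φ.pos ≫ ψ.pos) D'.src) ≫ D'.tgt = g ≫ D'.src)
    (h₁ : (a ≫ pullback.fst (φ.pos ≫ ψ.pos) D'.src) ≫ φ.pos ≫ ψ.pos =
      (pullback.lift (a ≫ pullback.snd (φ.pos ≫ ψ.pos) D'.src) g hg ≫ D'.mul) ≫ D'.src)
    (h₂ : (a ≫ compDir φ ψ ≫ C.tgt) ≫ φ.pos ≫ ψ.pos = g ≫ D'.src)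
    (h₃ : (a ≫ compDir φ ψ) ≫ C.tgt =
      (pullback.lift (a ≫ compDir φ ψ ≫ C.tgt) g h₂ ≫ compDir φ ψ) ≫ C.src) :
    pullback.lift (a ≫ pullback.fst (φ.pos ≫ ψ.pos) D'.src)
        (pullback.lift (a ≫ pullback.snd (φ.pos ≫ ψ.pos) D'.src) g hg ≫ D'.mul) h₁ ≫
          compDir φ ψ =
      pullback.lift (a ≫ compDir φ ψ)
        (pullback.lift (a ≫ compDir φ ψ ≫ C.tgt) g h₂ ≫ compDir φ ψ) h₃ ≫ C.mul := by
  have hx : ((a ≫ pullback.fst (φ.pos ≫ ψ.pos) D'.src) ≫ φ.pos) ≫ ψ.pos =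
      (a ≫ pullback.snd (φ.pos ≫ ψ.pos) D'.src) ≫ D'.src := by
    simp only [Category.assoc]
    rw [← pullback.condition]
  have ha : a ≫ compDir φ ψ = φ.app (a ≫ pullback.fst (φ.pos ≫ ψ.pos) D'.src)
      (ψ.app ((a ≫ pullback.fst (φ.pos ≫ ψ.pos) D'.src) ≫ φ.pos)
        (a ≫ pullback.snd (φ.pos ≫ ψ.pos) D'.src) hx) (by simp) := by
    rw [compDir, comp_app]
    refine app_congr _ _ rfl ?_
    rw [comp_app]
    exact app_congr _ _ (Category.assoc _ _ _).symm rfl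
  have hb : a ≫ compDir φ ψ ≫ C.tgt = φ.app (a ≫ pullback.fst (φ.pos ≫ ψ.pos) D'.src)
      (ψ.app ((a ≫ pullback.fst (φ.pos ≫ ψ.pos) D'.src) ≫ φ.pos)
        (a ≫ pullback.snd (φ.pos ≫ ψ.pos) D'.src) hx) (by simp) ≫ C.tgt := by
    rw [← ha, Category.assoc]
  rw [lift_compDir]
  refine (app_congr φ _ rfl (app_gmul ψ _ _ g hx hg ((Category.assoc _ _ _).trans h₁))).trans ?_
  rw [app_gmul φ _ _ _ (by simp) (by simp)]
  refine gmul_congr _ ha.symm ?_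
  rw [lift_compDir]
  refine app_congr φ _ hb.symm (app_congr ψ _ ?_ rfl)
  exact ((congrArg (fun k => k ≫ φ.pos) hb).trans
    ((Category.assoc _ _ _).trans (app_tgt φ _ _ _))).symm

/-- The composite of internal cofunctors. -/
def comp (φ : Cofunctor C D) (ψ : Cofunctor D D') : Cofunctor C D' where
  pos := φ.pos ≫ ψ.pos
  dir := compDir φ ψ
  dir_src := by simp [compDir]
  map_ident := by
    rw [lift_compDir]
    refine (app_congr φ (x' := 𝟙 _ ) (f' := 𝟙 _ ≫ φ.pos ≫ D.ident) _ rfl ?_).trans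
      ((app_ident φ (𝟙 _ ) (by simp [D.ident_src])).trans (Category.id_comp _))
    refine (app_congr ψ (x' := φ.pos) (f' := φ.pos ≫ ψ.pos ≫ D'.ident) _
      (Category.id_comp _) (Category.assoc _ _ _)).trans ?_
    rw [app_ident, Category.id_comp]
  map_tgt := by
    rw [← Category.assoc C.tgt, ← Category.assoc]
    simp [compDir]
  map_mul := compDir_mul φ ψ _ _ _ _ _ _

theorem id_app (C : InternalCategory E) {B : E} (x : B ⟶ C.obj) (f : B ⟶ C.arr)
    (h : x ≫ (Cofunctor.id C).pos = f ≫ C.src) : (Cofunctor.id C).app x f h = f :=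
  pullback.lift_snd _ _ _

theorem comp_app' (φ : Cofunctor C D) (ψ : Cofunctor D D') {B : E} (x : B ⟶ C.obj)
    (f : B ⟶ D'.arr) (h : x ≫ (Cofunctor.comp φ ψ).pos = f ≫ D'.src) :
    (Cofunctor.comp φ ψ).app x f h =
      φ.app x (ψ.app (x ≫ φ.pos) f (by simpa [comp] using h)) (by simp) :=
  lift_compDir φ ψ x f h

end Cofunctor

instance : Category (InternalCategory E) where
  Hom C D := Cofunctor C D
  id C := Cofunctor.id C
  comp φ ψ := Cofunctor.comp φ ψ
  id_comp φ := by
    refine Cofunctor.ext_app (Category.id_comp _) ?_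
    intro B x f h h'
    rw [Cofunctor.comp_app', Cofunctor.id_app]
    exact Cofunctor.app_congr _ _ (Category.comp_id _) rfl
  comp_id φ := by
    refine Cofunctor.ext_app (Category.comp_id _) ?_
    intro B x f h h'
    rw [Cofunctor.comp_app']
    exact Cofunctor.app_congr _ _ rfl (Cofunctor.id_app _ _ _ _)
  assoc φ ψ χ := by
    refine Cofunctor.ext_app (Category.assoc _ _ _) ?_
    intro B x f h h'
    rw [Cofunctor.comp_app', Cofunctor.comp_app', Cofunctor.comp_app']
    refine Cofunctor.app_congr _ _ rfl ?_
    rw [Cofunctor.comp_app']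
    exact Cofunctor.app_congr _ _ rfl (Cofunctor.app_congr _ _ (Category.assoc _ _ _).symm rfl)

variable (E) in
/-- The category of internal categories in `E` whose source morphism is exponentiable, and
internal cofunctors. -/
abbrev ExpInternalCategory : Type max u v :=
  ObjectProperty.FullSubcategory fun C : InternalCategory E => IsExponentiable C.src

variable (E) in
/-- The functor that sends an internal category to its source morphism and an internal cofunctor
to its underlying morphism of polynomials. -/
def underlyingPoly : ExpInternalCategory E ⥤ Poly E where
  obj C := ⟨C.obj.obj, C.obj.arr, C.obj.src, C.property⟩
  map {C D} φ :=
    have φ' : Cofunctor C.obj D.obj := φ.hom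
    (⟨φ'.pos, φ'.dir, φ'.dir_src⟩ : Poly.Hom _ _)
  map_id C := by
    rfl
  map_comp {C D D'} φ ψ := by
    rfl

end Internal

end

end PolyComon

namespace PolyComon

noncomputable section

attribute [local simp] pullback.lift_fst pullback.lift_fst_assoc pullback.lift_snd
  pullback.lift_snd_assoc

variable {E : Type u} [Category.{v} E] [HasFiniteLimits E]

/-! ### Category structure extracted from a comonoid, on generalized elements. -/

namespace Poly

/-! By the adjunction defining the dependent product, a position of `tri p p` is a position `I` of
`p` with a map `J` from its fibre to the positions of `p`, so every equation between morphisms of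
polynomials can be tested on generalized elements, separately on positions and on directions.

Since `y` has one position and one direction, a counit amounts to a section of `p.hom`: the
identities. The comultiplication sends a position `x` to a pair `(I, J)`. The right counit law on
positions forces `I = x` (`comulPos_π`), so only the maps `J` remain, and together they are one map
`tgt` from directions to positions (`ev_comulPos`). A direction over this pair is then a composable
pair of directions starting at `x`, and the direction part of the comultiplication is a composition
with the right source (`comul_app`, `gmul_hom`). The other laws become the category axioms: the left
counit law on positions is `ident_tgt`, the two counit laws on directions are `ident_gmul` and
`gmul_ident`, coassociativity on positions is `gmul_tgt`, and coassociativity on directions is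
`gmul_assoc`. Read backwards, the same dictionary makes a comonoid from an internal category
(`toTriComonoid`).

For a morphism of polynomials, compatibility with the counits says that identities are preserved;
compatibility with the comultiplications says on positions that targets are preserved, and on
directions that composites are. These are the cofunctor axioms.

The passages are inverse on objects as strict equalities. On morphisms both leave the pair of
components untouched, and both categories are faithful over `Poly E`, so equality of the functors
follows from equality on objects (`functor_eq_id_of_faithful`). -/

/-- A comonoid for the composition product, with its laws spelled out. -/
structure TriComonoid (p : Poly E) where
  /-- the counit -/
  counit : p ⟶ y
  /-- the comultiplication -/
  comul : p ⟶ tri p p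
  counit_comul : comul ≫ triMap counit (𝟙 p) = leftInv p
  comul_counit : comul ≫ triMap (𝟙 p) counit = rightInv p
  comul_assoc : comul ≫ triMap (𝟙 p) comul =
    comul ≫ triMap comul (𝟙 p) ≫ assocHom p p p

namespace TriComonoid

variable {p : Poly E} (c : TriComonoid p)

theorem ext' {c c' : TriComonoid p} (h₁ : c.counit = c'.counit) (h₂ : c.comul = c'.comul) :
    c = c' := by
  cases c
  cases c'
  cases h₁
  cases h₂
  rfl

/-- The proof argument of `Hom.app` mentions the morphism, so a plain rewrite is awkward. This form
is how each comonoid law is evaluated at a chosen direction. -/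
theorem app_eq_of_eq {q : Poly E} {φ ψ : p ⟶ q} (e : φ = ψ) {B : E} (x : B ⟶ p.pos)
    (z : B ⟶ q.dir) (h : x ≫ Hom.pos φ = z ≫ q.hom) :
    Hom.app φ x z h = Hom.app ψ x z (by rw [← e, h]) := by
  subst e
  rfl

/-- The comultiplication on generalized positions. -/
def comulPos {B : E} (x : B ⟶ p.pos) : B ⟶ (tri p p).pos := x ≫ Hom.pos c.comul

@[simp] theorem comp_comul_pos {B : E} (x : B ⟶ p.pos) :
    x ≫ Hom.pos c.comul = c.comulPos x := by
  rw [comulPos]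

@[simp] theorem comp_comulPos {B C : E} (w : C ⟶ B) (x : B ⟶ p.pos) :
    w ≫ c.comulPos x = c.comulPos (w ≫ x) :=
  (Category.assoc _ _ _).symm

-- The right counit law on positions: tensoring with the counit on the right does not change the
-- first component, and the inverse right unitor has first component `x`.
@[simp] theorem comulPos_π {B : E} (x : B ⟶ p.pos) : c.comulPos x ≫ triπ p p = x := by
  have := congrArg (fun k => (x ≫ Hom.pos k) ≫ triπ p y) c.comul_counit
  simpa using this

/-- The target of a direction. -/
def tgt : p.dir ⟶ p.pos := ev (c.comulPos p.hom) (𝟙 _) (by simp)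

/-- The identity direction at a position. -/
def ident : p.pos ⟶ p.dir := Hom.app c.counit (𝟙 _) (oneDir _) (one_ext _ _)

-- `tgt` is the evaluation at the generic direction, and naturality of `ev` transports it to every
-- `u`; the hypothesis forces `x` to be the source of `u`.
@[simp] theorem ev_comulPos {B : E} (x : B ⟶ p.pos) (u : B ⟶ p.dir)
    (h : c.comulPos x ≫ triπ p p = u ≫ p.hom) : ev (c.comulPos x) u h = u ≫ c.tgt := by
  have hx : x = u ≫ p.hom := by simpa using h
  subst hx
  rw [tgt, comp_ev]
  exact ev_congr _ (by simp) (by simp)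

/-- Directions of `y` are unique, so only the position matters, and it is a pullback of the generic
one used in `ident`. -/
theorem counit_app {B : E} (x : B ⟶ p.pos) (z : B ⟶ (y : Poly E).dir)
    (h : x ≫ Hom.pos c.counit = z ≫ (y : Poly E).hom) :
    Hom.app c.counit x z h = x ≫ c.ident := by
  rw [ident, Hom.comp_app]
  exact Hom.app_congr _ _ (by simp) (one_ext' _ _)

@[simp] theorem ident_hom : c.ident ≫ p.hom = 𝟙 _ :=
  Hom.app_hom _ _ _ _

@[simp] theorem ident_tgt : c.ident ≫ c.tgt = 𝟙 _ := by
  -- The left counit law at the generic position, read through the left unitor: the left side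
  -- becomes the comultiplication evaluated at the identity direction.
  have := congrArg (fun k => leftPos (𝟙 _ ≫ Hom.pos k)) c.counit_comul
  simp only [comp_leftInv_pos, leftPos_inv] at this
  rw [← this]
  simp [leftPos, counit_app]

/-- Composition of generalized directions. -/
def gmul {B : E} (f g : B ⟶ p.dir) (h : f ≫ c.tgt = g ≫ p.hom) : B ⟶ p.dir :=
  Hom.app c.comul (f ≫ p.hom) (triDir (c.comulPos (f ≫ p.hom)) f g (by simp)
    (by rw [ev_comulPos, h])) (by simp)

theorem gmul_congr {B : E} {f f' g g' : B ⟶ p.dir} (h : f ≫ c.tgt = g ≫ p.hom) (hf : f = f')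
    (hg : g = g') : c.gmul f g h = c.gmul f' g' (by rw [← hf, ← hg, h]) := by
  subst hf hg
  rfl

theorem comp_gmul {A B : E} (w : A ⟶ B) (f g : B ⟶ p.dir) (h : f ≫ c.tgt = g ≫ p.hom) :
    w ≫ c.gmul f g h = c.gmul (w ≫ f) (w ≫ g) (by simp [h]) := by
  rw [gmul, Hom.comp_app]
  exact Hom.app_congr _ _ (by simp) (by simp)

/-- The position `x` is redundant, being the source of the first component of `d`; hence the whole
direction part of the comultiplication is the binary operation `gmul`. -/
theorem comul_app {B : E} (x : B ⟶ p.pos) (d : B ⟶ (tri p p).dir)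
    (h : x ≫ Hom.pos c.comul = d ≫ triHom p p) :
    Hom.app c.comul x d h = c.gmul (d ≫ triU p p) (d ≫ triV p p)
      (by rw [← cond_V h]; exact (c.ev_comulPos x _ _).symm) := by
  have hx : x = (d ≫ triU p p) ≫ p.hom := by
    rw [← cond_U h, comp_comul_pos, comulPos_π]
  refine Hom.app_congr _ _ hx (triDir_ext ?_ (by simp) (by simp))
  rw [← h, triDir_hom]
  exact congrArg (fun k => k ≫ Hom.pos c.comul) hx

theorem gmul_hom {B : E} (f g : B ⟶ p.dir) (h : f ≫ c.tgt = g ≫ p.hom) :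
    c.gmul f g h ≫ p.hom = f ≫ p.hom := by
  simp [gmul]

/-- The left counit law evaluated at the direction of `tri y p` whose two components are the unique
direction of `y` and `g`. -/
theorem ident_gmul {B : E} (x : B ⟶ p.pos) (g : B ⟶ p.dir)
    (h : (x ≫ c.ident) ≫ c.tgt = g ≫ p.hom) : c.gmul (x ≫ c.ident) g h = g := by
  have hx : x = g ≫ p.hom := by simpa using h
  have h₁ : x ≫ Hom.pos (leftInv p) = triDir (leftInvPos x) (oneDir B) g (one_ext _ _)
      (by rw [ev_one, leftPos_inv, hx]) ≫ triHom y p := by simp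
  have := app_eq_of_eq c.counit_comul x (triDir (leftInvPos x) (oneDir B) g (one_ext _ _)
      (by rw [ev_one, leftPos_inv, hx])) (by rw [c.counit_comul]; exact h₁)
  simp only [leftInv_app, triDir_V, comp_app, comul_app] at this
  refine Eq.trans ?_ this
  exact gmul_congr _ _ (by simp [counit_app]) (by simp)

/-- The right counit law evaluated at the direction of `tri p y` given by `f` and the unique
direction of `y`. -/
theorem gmul_ident {B : E} (f : B ⟶ p.dir) (x : B ⟶ p.pos)
    (h : f ≫ c.tgt = (x ≫ c.ident) ≫ p.hom) : c.gmul f (x ≫ c.ident) h = f := by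
  have hx : f ≫ c.tgt = x := by simpa using h
  have h₁ : (f ≫ p.hom) ≫ Hom.pos (rightInv p) = triDir (rightInvPos (f ≫ p.hom)) f (oneDir B)
      (by simp) (one_ext _ _) ≫ triHom p y := by simp
  have := app_eq_of_eq c.comul_counit (f ≫ p.hom) (triDir (rightInvPos (f ≫ p.hom)) f (oneDir B)
      (by simp) (one_ext _ _)) (by rw [c.comul_counit]; exact h₁)
  simp only [rightInv_app, triDir_U, comp_app, comul_app] at this
  refine Eq.trans ?_ this
  exact gmul_congr _ _ (by simp) (by simp [counit_app, ← hx])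

/-- Coassociativity on positions. Evaluating at `f` and then at `g`, one side gives the target of
`g` and the other the target of the composite. -/
theorem gmul_tgt {B : E} (f g : B ⟶ p.dir) (h : f ≫ c.tgt = g ≫ p.hom) :
    c.gmul f g h ≫ c.tgt = g ≫ c.tgt := by
  have e := congrArg (fun k => (f ≫ p.hom) ≫ Hom.pos k) c.comul_assoc
  simp only [comp_pos, comp_comul_pos, comp_triMap_pos, comp_triMapPos,
    comp_assocHom_pos, comp_assocPos] at e
  have e₁ := ev_congr (u := f) (by simp) e rfl
  simp only [ev_triMapPos, ev_assocPos, id_app, ev_comulPos, comp_comul_pos] at e₁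
  have e₂ := ev_congr (u := g) (by simp [h]) e₁ rfl
  simp only [ev_assocInner, ev_comulPos, ev_triMapPos, comul_app, id_pos, Category.comp_id,
    triDir_U, triDir_V] at e₂
  exact e₂.symm

/-- Coassociativity on directions, evaluated at the nested triple `(f, (g, k))`. The statement
already needs `gmul_tgt` to be well typed. -/
theorem gmul_assoc {B : E} (f g k : B ⟶ p.dir) (h : f ≫ c.tgt = g ≫ p.hom)
    (h' : g ≫ c.tgt = k ≫ p.hom) :
    c.gmul (c.gmul f g h) k (by rw [gmul_tgt, h']) =
      c.gmul f (c.gmul g k h') (by rw [gmul_hom, h]) := by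
  -- The base position of the triple is taken to be the image of the source of `f` itself, so the
  -- triple lies over it by construction.
  have h₁ : (f ≫ p.hom) ≫ Hom.pos (c.comul ≫ triMap (𝟙 p) c.comul) =
      triDir ((f ≫ p.hom) ≫ Hom.pos (c.comul ≫ triMap (𝟙 p) c.comul)) f
        (triDir (c.comulPos (f ≫ c.tgt)) g k (by simp [h]) (by simp [h']))
        (by simp) (by simp) ≫ triHom _ _ := by simp
  have e := app_eq_of_eq c.comul_assoc _ _ h₁
  simp only [comp_app, comul_app] at e
  refine Eq.trans ?_ (e.symm.trans ?_)
  · refine c.gmul_congr _ ?_ ?_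
    · simp [comul_app]
    · simp
  · refine c.gmul_congr _ ?_ ?_
    · simp
    · simp [comul_app]

end TriComonoid
end Poly

/-! ### The comonoid of an internal category. -/

namespace InternalCategory

open Cofunctor

variable (C : InternalCategory E)

theorem gmul_src {B : E} (f g : B ⟶ C.arr) (h : f ≫ C.tgt = g ≫ C.src) :
    C.gmul f g h ≫ C.src = f ≫ C.src := by
  simp [gmul, C.mul_src]

theorem gmul_tgt {B : E} (f g : B ⟶ C.arr) (h : f ≫ C.tgt = g ≫ C.src) :
    C.gmul f g h ≫ C.tgt = g ≫ C.tgt := by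
  simp [gmul, C.mul_tgt]

@[simp] theorem comp_ident_src {B : E} (x : B ⟶ C.obj) : x ≫ C.ident ≫ C.src = x := by
  rw [C.ident_src, Category.comp_id]

@[simp] theorem comp_ident_tgt {B : E} (x : B ⟶ C.obj) : x ≫ C.ident ≫ C.tgt = x := by
  rw [C.ident_tgt, Category.comp_id]

theorem ident_gmul {B : E} (x : B ⟶ C.obj) (g : B ⟶ C.arr)
    (h : (x ≫ C.ident) ≫ C.tgt = g ≫ C.src) : C.gmul (x ≫ C.ident) g h = g := by
  have hx : x = g ≫ C.src := by simpa using h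
  have := congrArg (fun k => g ≫ k) C.ident_mul
  simp only [← Category.assoc, comp_lift, Category.comp_id] at this
  subst hx
  exact this

theorem gmul_ident {B : E} (f : B ⟶ C.arr) (x : B ⟶ C.obj)
    (h : f ≫ C.tgt = (x ≫ C.ident) ≫ C.src) : C.gmul f (x ≫ C.ident) h = f := by
  have hx : x = f ≫ C.tgt := by simpa using h.symm
  have := congrArg (fun k => f ≫ k) C.mul_ident
  simp only [← Category.assoc, comp_lift, Category.comp_id] at this
  subst hx
  exact this

theorem gmul_assoc {B : E} (f g k : B ⟶ C.arr) (h : f ≫ C.tgt = g ≫ C.src)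
    (h' : g ≫ C.tgt = k ≫ C.src) :
    C.gmul (C.gmul f g h) k (by rw [gmul_tgt, h']) =
      C.gmul f (C.gmul g k h') (by rw [gmul_src, h]) := by
  -- The axiom concerns the generic composable triple, bracketed as a pair followed by an arrow; it
  -- is restricted along the classifying map of `((f, g), k)`.
  have := congrArg (fun m => pullback.lift (f := pullback.snd C.tgt C.src ≫ C.tgt)
    (pullback.lift f g h) k (by simpa using h') ≫ m) C.mul_assoc
  simpa [gmul, comp_lift, ← Category.assoc] using this

variable {C} in
/-- The source morphism as a polynomial. -/
abbrev poly (hC : IsExponentiable C.src) : Poly E := ⟨C.obj, C.arr, C.src, hC⟩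

variable {C} (hC : IsExponentiable C.src)

open _root_.PolyComon.Poly

/-- The comultiplication on generalized positions: a position with the targets of its
directions. -/
def comulPos {B : E} (x : B ⟶ (poly hC).pos) : B ⟶ (tri (poly hC) (poly hC)).pos :=
  triPos x (pullback.snd x (poly hC).hom ≫ C.tgt)

@[simp] theorem comp_comulPos {A B : E} (w : A ⟶ B) (x : B ⟶ (poly hC).pos) :
    w ≫ comulPos hC x = comulPos hC (w ≫ x) :=
  comp_triPos_eq _ _ _ _ _ rfl (by intros; simp)

@[simp] theorem comulPos_π {B : E} (x : B ⟶ (poly hC).pos) :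
    comulPos hC x ≫ triπ (poly hC) (poly hC) = x :=
  triPos_π _ _

@[simp] theorem comulPos_π_assoc {B Z : E} (x : B ⟶ (poly hC).pos) (k : (poly hC).pos ⟶ Z) :
    comulPos hC x ≫ triπ (poly hC) (poly hC) ≫ k = x ≫ k :=
  triPos_π_assoc _ _ _

@[simp] theorem ev_comulPos {B : E} (x : B ⟶ (poly hC).pos) (u : B ⟶ (poly hC).dir)
    (h : comulPos hC x ≫ triπ (poly hC) (poly hC) = u ≫ (poly hC).hom) :
    ev (comulPos hC x) u h = u ≫ C.tgt := by
  simp [comulPos]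

/-- The directions over `comulPos hC x` are composable pairs; with `triU_src`, which fixes the
source, this makes `comulHom` well defined. -/
theorem triU_tgt {B : E} {x : B ⟶ (poly hC).pos} {d : B ⟶ (tri (poly hC) (poly hC)).dir}
    (h : comulPos hC x = d ≫ triHom (poly hC) (poly hC)) :
    (d ≫ triU (poly hC) (poly hC)) ≫ C.tgt = (d ≫ triV (poly hC) (poly hC)) ≫ C.src := by
  refine Eq.trans ?_ (cond_V h)
  rw [ev_comulPos]

theorem triU_src {B : E} {x : B ⟶ (poly hC).pos} {d : B ⟶ (tri (poly hC) (poly hC)).dir}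
    (h : comulPos hC x = d ≫ triHom (poly hC) (poly hC)) :
    (d ≫ triU (poly hC) (poly hC)) ≫ C.src = x :=
  (cond_U h).symm.trans (comulPos_π hC x)

/-- The counit of the comonoid of an internal category. -/
def counitHom : poly hC ⟶ y :=
  Hom.ofElements (one _) (fun _ x _ _ => x ≫ C.ident) (fun _ x _ _ => by simp)

@[simp] theorem counitHom_app {B : E} (x : B ⟶ (poly hC).pos) (z : B ⟶ (y : Poly E).dir)
    (h : x ≫ Hom.pos (counitHom hC) = z ≫ (y : Poly E).hom) :
    Hom.app (counitHom hC) x z h = x ≫ C.ident :=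
  Hom.ofElements_app _ _ _ (by intros; simp) x z h

/-- The comultiplication of the comonoid of an internal category. -/
def comulHom : poly hC ⟶ tri (poly hC) (poly hC) :=
  Hom.ofElements (comulPos hC (𝟙 _))
    (fun B x d h => C.gmul (d ≫ triU _ _) (d ≫ triV _ _)
      (triU_tgt hC (x := x) (by rw [← h, comp_comulPos, Category.comp_id])))
    (fun B x d h => (C.gmul_src _ _ _).trans
      (triU_src hC (by rw [← h, comp_comulPos, Category.comp_id])))

@[simp] theorem comp_comulHom_pos {B : E} (x : B ⟶ (poly hC).pos) :
    x ≫ Hom.pos (comulHom hC) = comulPos hC x := by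
  simp [comulHom, Hom.ofElements]

@[simp] theorem comp_comulHom_pos_assoc {B Z : E} (x : B ⟶ (poly hC).pos)
    (k : (tri (poly hC) (poly hC)).pos ⟶ Z) :
    x ≫ Hom.pos (comulHom hC) ≫ k = comulPos hC x ≫ k := by
  rw [← Category.assoc, comp_comulHom_pos]

@[simp] theorem comulHom_app {B : E} (x : B ⟶ (poly hC).pos)
    (d : B ⟶ (tri (poly hC) (poly hC)).dir)
    (h : x ≫ Hom.pos (comulHom hC) = d ≫ triHom (poly hC) (poly hC)) :
    Hom.app (comulHom hC) x d h = C.gmul (d ≫ triU _ _) (d ≫ triV _ _)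
      (triU_tgt hC (x := x) (by rw [← h, comp_comulHom_pos])) :=
  Hom.ofElements_app _ _ _ (by intros; simp) x d h

/-- The comonoid of an internal category whose source morphism is exponentiable. -/
def toTriComonoid : TriComonoid (poly hC) where
  counit := counitHom hC
  comul := comulHom hC
  counit_comul := by
    apply tri_hom_ext
    · intro B x
      apply triPos_ext
      · exact one_ext _ _
      · intro D w u h h'
        simp [ev_one]
        -- What remains on positions is that the identity at a point has that point as target.
        simp [leftPos]
    · intro B x d h h'
      simp
      exact C.ident_gmul _ _ _
  comul_counit := by
    apply tri_hom_ext
    · intro B x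
      apply triPos_ext
      · simp
      · intro D w u h h'
        exact one_ext _ _
    · intro B x d h h'
      simp
      -- The counit inserts the identity at the target of the first component; it is rebracketed to
      -- match the right unit law.
      refine (gmul_congr _ rfl ?_).trans (C.gmul_ident _ (d ≫ triU _ _ ≫ C.tgt) (by simp))
      simp
  comul_assoc := by
    apply tri_hom_ext
    · intro B x
      apply triPos_ext
      · simp
      · intro D w u h h'
        apply triPos_ext
        · simp
        · intro D' w' u' k k'
          simp
          -- On positions, after evaluation at two successive arrows, coassociativity is the target
          -- law for composites; on directions it is associativity.
          exact (C.gmul_tgt _ _ _).symm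
    · intro B x d h h'
      simp
      exact (C.gmul_assoc _ _ _ _ _).symm

end InternalCategory

/-! ### The internal category of a comonoid. -/

namespace Poly.TriComonoid

variable {p : Poly E} (c : TriComonoid p)

/-- Composition on the generic composable pair determines it on all pairs. This translates between
`mul`, as the axioms of an internal category use it, and `gmul`. -/
theorem lift_gmul {B : E} (f g : B ⟶ p.dir) (h : f ≫ c.tgt = g ≫ p.hom) :
    pullback.lift f g h ≫ c.gmul (pullback.fst c.tgt p.hom) (pullback.snd c.tgt p.hom)
      pullback.condition = c.gmul f g h := by
  rw [comp_gmul]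
  exact c.gmul_congr _ (pullback.lift_fst _ _ _) (pullback.lift_snd _ _ _)

/-- The internal category of a comonoid. -/
def toInternalCategory : InternalCategory E where
  obj := p.pos
  arr := p.dir
  src := p.hom
  tgt := c.tgt
  ident := c.ident
  mul := c.gmul (pullback.fst c.tgt p.hom) (pullback.snd c.tgt p.hom) pullback.condition
  ident_src := c.ident_hom
  ident_tgt := c.ident_tgt
  mul_src := c.gmul_hom _ _ _
  mul_tgt := c.gmul_tgt _ _ _
  ident_mul := (c.lift_gmul _ _ _).trans (c.ident_gmul _ _ _)
  mul_ident := (c.lift_gmul _ _ _).trans (c.gmul_ident _ _ _)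
  mul_assoc := by
    simp only [comp_gmul, pullback.lift_fst, pullback.lift_snd]
    exact c.gmul_assoc _ _ _ _ _

end Poly.TriComonoid

/-! ### The two constructions are strictly inverse on objects. -/

namespace InternalCategory

/-- The domain of a composition depends on the target map, and the two targets compared later agree
only propositionally; agreement on generalized pairs then suffices for heterogeneous equality. -/
theorem mul_heq {O A : E} {s t t' : A ⟶ O} {m : pullback t s ⟶ A} {m' : pullback t' s ⟶ A}
    (ht : t = t') (hm : ∀ (B : E) (f g : B ⟶ A) (h : f ≫ t = g ≫ s) (h' : f ≫ t' = g ≫ s),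
      pullback.lift f g h ≫ m = pullback.lift f g h' ≫ m') : HEq m m' := by
  subst ht
  rw [heq_eq_eq, ← Category.id_comp m, ← Category.id_comp m']
  have e : 𝟙 (pullback t s) = pullback.lift (pullback.fst t s) (pullback.snd t s)
      pullback.condition := by
    apply pullback.hom_ext <;> simp
  rw [e]
  exact hm _ _ _ _ _

variable {C : InternalCategory E} (hC : IsExponentiable C.src)

theorem toTriComonoid_tgt : (toTriComonoid hC).tgt = C.tgt :=
  (Poly.ev_congr (p := poly hC) (q := poly hC) _ (comp_comulHom_pos hC C.src) rfl).trans
    ((ev_comulPos hC _ _ _).trans (Category.id_comp _))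

theorem toTriComonoid_ident : (toTriComonoid hC).ident = C.ident :=
  (counitHom_app hC _ _ _).trans (Category.id_comp _)

theorem toTriComonoid_gmul {B : E} (f g : B ⟶ C.arr)
    (h : f ≫ (toTriComonoid hC).tgt = g ≫ C.src) :
    (toTriComonoid hC).gmul f g h = C.gmul f g (by rw [← h, toTriComonoid_tgt]) := by
  refine (comulHom_app hC _ _ _).trans (Cofunctor.gmul_congr _ ?_ ?_)
  · exact Poly.triDir_U _ _ _ _ _
  · exact Poly.triDir_V _ _ _ _ _

theorem toTriComonoid_toInternalCategory : (toTriComonoid hC).toInternalCategory = C := by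
  have ht := toTriComonoid_tgt hC
  have hi := toTriComonoid_ident hC
  have hm : HEq (toTriComonoid hC).toInternalCategory.mul C.mul :=
    mul_heq ht fun B f g h h' =>
      ((toTriComonoid hC).lift_gmul f g h).trans (toTriComonoid_gmul hC f g h)
  -- Only the target, identities and composition are still needed; an opaque comonoid keeps its
  -- construction out of the goal while `C` is taken apart.
  generalize hc : toTriComonoid hC = c at *
  clear hc
  obtain ⟨O, A, s, t, i, m, _⟩ := C
  simp only [Poly.TriComonoid.toInternalCategory, InternalCategory.mk.injEq, heq_eq_eq, true_and]
  exact ⟨ht, hi, hm⟩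

end InternalCategory

namespace Poly.TriComonoid

variable {p q : Poly E} (c : TriComonoid p) (c' : TriComonoid q)

/-- A comonoid is determined by its `ident`, `tgt` and `gmul`: `counit_app` recovers the counit,
`comulPos_π` and `ev_comulPos` the comultiplication on positions, and `comul_app` its action on
directions. -/
theorem toInternalCategory_toTriComonoid :
    InternalCategory.toTriComonoid (C := c.toInternalCategory) p.exp = c := by
  apply TriComonoid.ext'
  · apply hom_ext
    · exact one_ext _ _
    · intro B x z h h'
      exact (InternalCategory.counitHom_app (C := c.toInternalCategory) p.exp x z h).trans
        (c.counit_app x z h').symm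
  · apply tri_hom_ext
    · intro B x
      refine (InternalCategory.comp_comulHom_pos (C := c.toInternalCategory) p.exp x).trans ?_
      apply triPos_ext
      · exact (InternalCategory.comulPos_π (C := c.toInternalCategory) p.exp x).trans
          (c.comulPos_π x).symm
      · intro D w u h h'
        refine (ev_congr (p := p) (q := p) h
          (InternalCategory.comp_comulPos (C := c.toInternalCategory) p.exp w x) rfl).trans ?_
        refine (InternalCategory.ev_comulPos (C := c.toInternalCategory) p.exp (w ≫ x) u _).trans ?_
        have e : w ≫ x ≫ Hom.pos c.comul = c.comulPos (w ≫ x) := (Category.assoc _ _ _).symm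
        exact (c.ev_comulPos (w ≫ x) u (e ▸ h')).symm.trans (ev_congr _ e.symm rfl)
    · intro B x d h h'
      refine (InternalCategory.comulHom_app (C := c.toInternalCategory) p.exp x d h).trans ?_
      exact (c.lift_gmul _ _ _).trans (c.comul_app x d h').symm

/-! ### Homomorphisms of comonoids and internal cofunctors. -/

variable {c c'} {φ : p ⟶ q}

theorem hom_app_ident (h₁ : φ ≫ c'.counit = c.counit) {B : E} (x : B ⟶ p.pos)
    (h : x ≫ Hom.pos φ = ((x ≫ Hom.pos φ) ≫ c'.ident) ≫ q.hom) :
    Hom.app φ x ((x ≫ Hom.pos φ) ≫ c'.ident) h = x ≫ c.ident := by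
  have := app_eq_of_eq h₁ x (oneDir _) (one_ext _ _)
  simp only [comp_app, counit_app] at this
  exact this

/-- Compatibility with comultiplication on positions, evaluated at `u`; its value on directions at a
pair is `hom_app_gmul`, whose statement depends on this one. -/
theorem hom_app_tgt (h₂ : φ ≫ c'.comul = c.comul ≫ triMap φ φ) {B : E} (x : B ⟶ p.pos)
    (u : B ⟶ q.dir) (h : x ≫ Hom.pos φ = u ≫ q.hom) :
    Hom.app φ x u h ≫ c.tgt ≫ Hom.pos φ = u ≫ c'.tgt := by
  have e := congrArg (fun k => x ≫ Hom.pos k) h₂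
  simp only [comp_pos, comp_comul_pos, comp_triMap_pos, comp_comulPos,
    comp_triMapPos] at e
  have e₁ := ev_congr (u := u) (by simpa using h) e rfl
  simp only [ev_comulPos, ev_triMapPos, comulPos_π] at e₁
  rw [e₁, Category.assoc]

theorem hom_app_gmul (h₂ : φ ≫ c'.comul = c.comul ≫ triMap φ φ) {B : E} (x : B ⟶ p.pos)
    (u v : B ⟶ q.dir) (h : x ≫ Hom.pos φ = u ≫ q.hom) (h' : u ≫ c'.tgt = v ≫ q.hom)
    (h'' : x ≫ Hom.pos φ = c'.gmul u v h' ≫ q.hom) :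
    Hom.app φ x (c'.gmul u v h') h'' =
      c.gmul (Hom.app φ x u h) (Hom.app φ (Hom.app φ x u h ≫ c.tgt) v
        (by rw [Category.assoc, hom_app_tgt h₂, h'])) (by simp) := by
  have e := app_eq_of_eq h₂ x (triDir (c'.comulPos (x ≫ Hom.pos φ)) u v (by simp [h]) (by simp [h']))
    (by simp)
  simp only [comp_app, comul_app] at e
  refine Eq.trans (Hom.app_congr _ _ rfl ?_) (e.trans ?_)
  · exact c'.gmul_congr _ (by simp) (by simp)
  · exact c.gmul_congr _ (by simp) (by simp)

theorem comp_dir (φ : p ⟶ q) {B : E} (w : B ⟶ pullback (Hom.pos φ) q.hom) :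
    w ≫ Hom.dir φ = Hom.app φ (w ≫ pullback.fst (Hom.pos φ) q.hom)
      (w ≫ pullback.snd (Hom.pos φ) q.hom)
      (by rw [Category.assoc, pullback.condition, Category.assoc]) :=
  (congrArg (fun k => w ≫ k) (Hom.dir_eq φ)).trans (Hom.comp_app _ _ _ _ _)

/-- The internal cofunctor of a homomorphism of comonoids. -/
def toCofunctor (h₁ : φ ≫ c'.counit = c.counit) (h₂ : φ ≫ c'.comul = c.comul ≫ triMap φ φ) :
    Cofunctor c.toInternalCategory c'.toInternalCategory where
  pos := Hom.pos φ
  dir := Hom.dir φ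
  dir_src := Hom.dir_hom φ
  map_ident := by
    refine Eq.trans ?_ ((hom_app_ident h₁ (𝟙 _) (by simp)).trans (Category.id_comp _))
    exact Hom.app_congr _ _ rfl (by rw [Category.id_comp]; rfl)
  map_tgt := by
    refine Eq.trans ?_ (hom_app_tgt h₂ (pullback.fst _ _) (pullback.snd _ _) pullback.condition)
    exact congrArg (fun k => k ≫ c.tgt ≫ Hom.pos φ) (Hom.dir_eq φ)
  map_mul := by
    -- The axiom lives on the generic object with two composable arrows over its image. The lift of
    -- the first arrow is rewritten as a value of `Hom.app`, so that `hom_app_gmul` applies, with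
    -- `lift_gmul` translating both compositions.
    have e := comp_dir φ (pullback.fst (pullback.snd (Hom.pos φ) q.hom ≫ c'.tgt) q.hom)
    refine (Hom.app_congr φ _ rfl (c'.lift_gmul _ _ _)).trans
      ((hom_app_gmul h₂ _ _ _ ?_ _ _).trans (Eq.trans ?_ (c.lift_gmul _ _ _).symm))
    · exact (Category.assoc _ _ _).trans
        ((congrArg (fun k => _ ≫ k) pullback.condition).trans (Category.assoc _ _ _).symm)
    · refine c.gmul_congr _ e.symm (Hom.app_congr φ _ ?_ rfl)
      exact (congrArg (fun k => k ≫ c.tgt) e.symm).trans (Category.assoc _ _ _)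

end Poly.TriComonoid

namespace Cofunctor

open _root_.PolyComon.Poly InternalCategory

variable {C D : InternalCategory E} (ψ : Cofunctor C D) (hC : IsExponentiable C.src)
  (hD : IsExponentiable D.src)

/-- The morphism of polynomials that underlies an internal cofunctor. -/
def toHom : poly hC ⟶ poly hD := (⟨ψ.pos, ψ.dir, ψ.dir_src⟩ : Poly.Hom (poly hC) (poly hD))

theorem toHom_counit : toHom ψ hC hD ≫ (toTriComonoid hD).counit = (toTriComonoid hC).counit := by
  apply hom_ext
  · exact one_ext _ _
  · intro B x z h h'
    rw [Poly.comp_app]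
    simp only [toTriComonoid, counitHom_app]
    refine Eq.trans ?_ (ψ.app_ident x (by simp))
    exact app_congr ψ _ rfl (Category.assoc _ _ _)

/-- On positions this is the target axiom of a cofunctor, and on directions its composition axiom.
-/
theorem toHom_comul : toHom ψ hC hD ≫ (toTriComonoid hD).comul =
    (toTriComonoid hC).comul ≫ triMap (toHom ψ hC hD) (toHom ψ hC hD) := by
  apply tri_hom_ext
  · intro B x
    apply triPos_ext
    · simp [toTriComonoid]
    · intro B' w u h h'
      simp [toTriComonoid]
      exact (ψ.app_tgt (w ≫ x) u _).symm
  · intro B x d h h'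
    simp [toTriComonoid]
    exact ψ.app_gmul x _ _ _ _ _

end Cofunctor

/-! ### The isomorphism of categories. -/

/-- The spelled out form of a comonoid for the composition product. -/
def Poly.TriComonoid.ofComonObj (p : Poly E) [ComonObj p] : TriComonoid p where
  counit := ComonObj.counit
  comul := ComonObj.comul
  -- Whiskering, unitors and associator of `Poly E` are by definition `triMap` with an identity,
  -- `leftIso`, `rightIso` and `assocIso`, so the laws coincide.
  counit_comul := ComonObj.counit_comul p
  comul_counit := ComonObj.comul_counit p
  comul_assoc := ComonObj.comul_assoc p

/-- A comonoid for the composition product from its spelled out form. -/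
abbrev Poly.TriComonoid.toComonObj {p : Poly E} (c : TriComonoid p) : ComonObj p where
  counit := c.counit
  comul := c.comul
  counit_comul := c.counit_comul
  comul_counit := c.comul_counit
  comul_assoc := c.comul_assoc

variable (E) in
/-- The internal category of a comonoid, as a functor. -/
def comonToInternal : Comon (Poly E) ⥤ ExpInternalCategory E where
  obj M := ⟨(Poly.TriComonoid.ofComonObj M.X).toInternalCategory, M.X.exp⟩
  map φ := ObjectProperty.homMk
    (Poly.TriComonoid.toCofunctor (φ := φ.hom) (IsComonHom.hom_counit φ.hom)
      (IsComonHom.hom_comul φ.hom))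
  -- Identities and composites of cofunctors are defined by the formulas for morphisms of
  -- polynomials, so functoriality is definitional.
  map_id _ := rfl
  map_comp _ _ := rfl

variable (E) in
/-- The comonoid of an internal category, as a functor. -/
def internalToComon : ExpInternalCategory E ⥤ Comon (Poly E) where
  -- The comonoid structure is data coming from `C`, not a canonical instance on the polynomial, so
  -- it is passed explicitly here and below.
  obj C := @Comon.mk _ _ _ (InternalCategory.poly C.property)
    (InternalCategory.toTriComonoid C.property).toComonObj
  map {C D} ψ := @Comon.Hom.mk _ _ _
    (@Comon.mk _ _ _ (InternalCategory.poly C.property)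
      (InternalCategory.toTriComonoid C.property).toComonObj)
    (@Comon.mk _ _ _ (InternalCategory.poly D.property)
      (InternalCategory.toTriComonoid D.property).toComonObj)
    (Cofunctor.toHom ψ.hom C.property D.property)
    (@IsComonHom.mk _ _ _ _ _ (_) (_) _ (Cofunctor.toHom_counit ψ.hom C.property D.property)
      (Cofunctor.toHom_comul ψ.hom C.property D.property))
  map_id _ := rfl
  map_comp _ _ := rfl

/-- Equality of functors compares morphisms up to transport along the object equalities. `U` carries
these transports to transports in `A'`, where `hU` gives the required equation; faithfulness
reflects it. -/
theorem functor_eq_id_of_faithful {A A' : Type*} [Category* A] [Category* A'] (U : A ⥤ A')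
    [U.Faithful] {H : A ⥤ A} (hobj : ∀ X, H.obj X = X) (hU : H ⋙ U = U) : H = 𝟭 A := by
  refine CategoryTheory.Functor.ext hobj fun X Y f => U.map_injective ?_
  have := Functor.congr_hom hU f
  simpa [eqToHom_map] using this

/-- A cofunctor is a pair of components subject to propositions, and the underlying morphism of
polynomials retains the pair. -/
instance : (underlyingPoly E).Faithful where
  map_injective {C D} φ ψ h := by
    apply ObjectProperty.hom_ext
    apply Cofunctor.ext_app
    · exact congrArg Poly.Hom.pos h
    · intro B x f k k'
      exact Poly.TriComonoid.app_eq_of_eq h x f k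

/-- The underlying polynomial is recovered definitionally, so only the comonoid structure on a fixed
`p` has to be compared. -/
theorem comonToInternal_obj_internalToComon (M : Comon (Poly E)) :
    (comonToInternal E ⋙ internalToComon E).obj M = M := by
  obtain ⟨p, hp⟩ := M
  exact congrArg (fun c : Poly.TriComonoid p => @Comon.mk _ _ _ p c.toComonObj)
    (Poly.TriComonoid.toInternalCategory_toTriComonoid (Poly.TriComonoid.ofComonObj p))

theorem internalToComon_obj_comonToInternal (C : ExpInternalCategory E) :
    (internalToComon E ⋙ comonToInternal E).obj C = C := by
  obtain ⟨C, hC⟩ := C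
  exact ObjectProperty.FullSubcategory.ext (InternalCategory.toTriComonoid_toInternalCategory hC)

theorem comonToInternal_comp_internalToComon :
    comonToInternal E ⋙ internalToComon E = 𝟭 (Comon (Poly E)) :=
  functor_eq_id_of_faithful (Comon.forget (Poly E)) comonToInternal_obj_internalToComon rfl

theorem internalToComon_comp_comonToInternal :
    internalToComon E ⋙ comonToInternal E = 𝟭 (ExpInternalCategory E) :=
  functor_eq_id_of_faithful (underlyingPoly E) internalToComon_obj_comonToInternal rfl

end

end PolyComon

theorem mainTheorem3 {E : Type u} [Category.{v} E] [HasFiniteLimits E] :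
    ∃ (F : Comon (PolyComon.Poly E) ⥤ PolyComon.ExpInternalCategory E)
      (G : PolyComon.ExpInternalCategory E ⥤ Comon (PolyComon.Poly E)),
      F ⋙ G = 𝟭 (Comon (PolyComon.Poly E)) ∧
      G ⋙ F = 𝟭 (PolyComon.ExpInternalCategory E) ∧
      F ⋙ PolyComon.underlyingPoly E = Comon.forget (PolyComon.Poly E) :=
  ⟨PolyComon.comonToInternal E, PolyComon.internalToComon E,
    PolyComon.comonToInternal_comp_internalToComon,
    -- The last clause is definitional: `comonToInternal` keeps the polynomial as source morphism
    -- and each pair of components as it is.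
    PolyComon.internalToComon_comp_comonToInternal, rfl⟩
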